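/- Let $(M,g)$ be a smooth Riemannian manifold, let $\mathbb TM=TM\oplus T^*M$ carry the pseudo-metric $\langle X+\xi,Y+\eta\rangle=\tfrac12(\xi(Y)+\eta(X))$ and the metric extending $g$ (by the dual metric on $T^*M$, with $TM\perp T^*M$). An almost quaternionic Hermitian structure on $(M,g)$ is a rank three subbundle $D\subset \mathrm{End}(TM)$ locally spanned by smooth $I,J,K=IJ$, where $I,J$ are $g$-orthogonal, anticommute and satisfy $I^2=J^2=-\mathrm{Id}$; it is quaternionic Kähler if $\nabla D\subset D$ for the Levi-Civita connection $\nabla$. A generalized almost quaternionic Hermitian structure on $(M,g)$ is a rank three subbundle $\mathcal D\subset\mathrm{End}(\mathbb TM)$ locally spanned by smooth $\mathcal I,\mathcal J,\mathcal K=\mathcal I\mathcal J$, where $\mathcal I,\mathcal J$ anticommute, satisfy $\mathcal I^2=\mathcal J^2=-\mathrm{Id}$ and preserve both the pseudo-metric and the metric on $\mathbb TM$; it is generalized quaternionic Kähler if $\nabla\mathcal D\subset\mathcal D$ for the connection that $\nabla$ induces on $\mathrm{End}(\mathbb TM)$. An algebra isomorphism $f:D^-\to D^+$ between two almost quaternionic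 Hermitian structures is a smooth bundle isomorphism that extends to an isomorphism of algebras $D^-\oplus\mathbb R\,\mathrm{Id}\to D^+\oplus\mathbb R\,\mathrm{Id}$ in each fibre. Put $C^\pm=\{X\pm g(X,\cdot)\mid X\in TM\}\subset\mathbb TM$, and let $p^\pm:C^\pm\to TM$ be the projections (isomorphisms). (Corollaire 4) If $\mathcal D$ is a generalized almost quaternionic Hermitian structure on $(M,g)$, every $u\in\mathcal D$ preserves $C^+$ and $C^-$. Writing $u^\pm=p^\pm\circ u|_{C^\pm}\circ(p^\pm)^{-1}$ and $D^\pm=\{u^\pm\mid u\in\mathcal D\}$, the subbundles $D^+$ and $D^-$ are almost quaternionic Hermitian structures on $(M,g)$, the map $f:D^-\to D^+$, $f(u^-)=u^+$ for $u\in\mathcal D$, is a well defined algebra isomorphism, and $\mathcal D\mapsto(D^-,D^+,f)$ is a bijection from the set of generalized almost quaternionic Hermitian structures on $(M,g)$ onto the set of triples consisting of two almost quaternionic Hermitian structures $D^-$, $D^+$ on $(M,g)$ and an algebra isomorphism $f:D^-\to D^+$. (Proposition 3) Let $\nabla$ be the Levi-Civita connection of $(M,g)$. A generalized almost quaternionic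 Hermitian structure $\mathcal D$ is generalized quaternionic Kähler if and only if (1) $D^+$ and $D^-$ are quaternionic Kähler structures on $(M,g)$, and (2) $\nabla_X (f(u^-))=f(\nabla_X u^-)$ for every local smooth section $u^-$ of $D^-$ and every tangent vector $X$. -/

import Mathlib

open Bundle FiberBundle
open scoped Manifold ContDiff Topology

noncomputable section

namespace GenQuat

set_option linter.unusedSectionVars false

section Connections

variable {E : Type*} [NormedAddCommGroup E] [NormedSpace ℝ E]
  {H : Type*} [TopologicalSpace H] {I : ModelWithCorners ℝ E H}
  {M : Type*} [TopologicalSpace M] [ChartedSpace H M]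
  {F : Type*} [NormedAddCommGroup F] [NormedSpace ℝ F]
  {V : M → Type*} [TopologicalSpace (TotalSpace F V)]
  [∀ x, AddCommGroup (V x)] [∀ x, Module ℝ (V x)] [∀ x, TopologicalSpace (V x)]
  [∀ x, IsTopologicalAddGroup (V x)] [∀ x, ContinuousSMul ℝ (V x)]
  [FiberBundle F V] [VectorBundle ℝ F V]
  {F' : Type*} [NormedAddCommGroup F'] [NormedSpace ℝ F']
  {W : M → Type*} [TopologicalSpace (TotalSpace F' W)]
  [∀ x, AddCommGroup (W x)] [∀ x, Module ℝ (W x)] [∀ x, TopologicalSpace (W x)]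
  [∀ x, IsTopologicalAddGroup (W x)] [∀ x, ContinuousSMul ℝ (W x)]
  [FiberBundle F' W] [VectorBundle ℝ F' W]

theorem mdiff_trivial {s : Π x, Bundle.Trivial M ℝ x} {x : M}
    (hs : MDifferentiableAt I (I.prod 𝓘(ℝ, ℝ))
      (fun y => TotalSpace.mk' ℝ (E := Bundle.Trivial M ℝ) y (s y)) x) :
    MDifferentiableAt I 𝓘(ℝ, ℝ) (fun y => (s y : ℝ)) x := by
  rw [mdifferentiableAt_section] at hs
  exact hs

variable (I M) in
/-- The flat connection `d` on the trivial line bundle. -/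
def trivialCov : CovariantDerivative I ℝ (Bundle.Trivial M ℝ) where
  toFun f x := mvfderiv I (fun y => (f y : ℝ)) x
  isCovariantDerivativeOnUniv :=
    { add := by
        intro s s' x hs hs' _
        exact mvfderiv_fun_add (mdiff_trivial hs) (mdiff_trivial hs')
      leibniz := by
        intro s g x hs hg _
        exact mvfderiv_fun_smul hg (mdiff_trivial hs) }

theorem mdiff_fst {s : Π x, V x × W x} {x : M}
    (hs : MDiffAt (fun y => TotalSpace.mk' (F × F') (E := V ×ᵇ W) y (s y)) x) :
    MDiffAt (fun y => TotalSpace.mk' F (E := V) y (s y).1) x := by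
  rw [mdifferentiableAt_section] at hs ⊢
  exact (ContinuousLinearMap.fst ℝ F F').differentiable.comp_mdifferentiableAt hs

theorem mdiff_snd {s : Π x, V x × W x} {x : M}
    (hs : MDiffAt (fun y => TotalSpace.mk' (F × F') (E := V ×ᵇ W) y (s y)) x) :
    MDiffAt (fun y => TotalSpace.mk' F' (E := W) y (s y).2) x := by
  rw [mdifferentiableAt_section] at hs ⊢
  exact (ContinuousLinearMap.snd ℝ F F').differentiable.comp_mdifferentiableAt hs

/-- The direct sum of two connections. -/
def prodCov (cV : CovariantDerivative I F V) (cW : CovariantDerivative I F' W) :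
    CovariantDerivative I (F × F') (V ×ᵇ W) where
  toFun s x := (cV (fun y => (s y).1) x).prod (cW (fun y => (s y).2) x)
  isCovariantDerivativeOnUniv :=
    { add := by
        intro s s' x hs hs' _
        ext v
        · exact congr($(cV.isCovariantDerivativeOnUniv.add (mdiff_fst hs) (mdiff_fst hs')) v)
        · exact congr($(cW.isCovariantDerivativeOnUniv.add (mdiff_snd hs) (mdiff_snd hs')) v)
      leibniz := by
        intro s g x hs hg _
        ext v
        · exact congr($(cV.isCovariantDerivativeOnUniv.leibniz (mdiff_fst hs) hg) v)
        · exact congr($(cW.isCovariantDerivativeOnUniv.leibniz (mdiff_snd hs) hg) v) }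

theorem mdiff_app  {u : Π x, V x →L[ℝ] W x}
    {s : Π x, V x} {x : M}
    (hu : MDiffAt (fun y => TotalSpace.mk' (F →L[ℝ] F') (E := fun z => V z →L[ℝ] W z) y (u y)) x)
    (hs : MDiffAt (fun y => TotalSpace.mk' F y (s y)) x) :
    MDiffAt (fun y => TotalSpace.mk' F' y (u y (s y))) x :=
  hu.clm_bundle_apply hs

variable [FiniteDimensional ℝ E] [FiniteDimensional ℝ F] [IsManifold I 2 M]
  [ContMDiffVectorBundle 1 F V I] 

theorem homCov_tensorial₁ (cV : CovariantDerivative I F V) (cW : CovariantDerivative I F' W)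
    (u : Π x, V x →L[ℝ] W x) (x : M) (s : Π x, V x) :
    TensorialAt I E (fun X : Π z : M, TangentSpace I z =>
      cW (fun y => u y (s y)) x (X x) - u x (cV s x (X x))) x where
  smul := by
    intro f X _ _
    simp [smul_sub]
  add := by
    intro X Y _ _
    simp
    abel

theorem homCov_tensorial₂ (cV : CovariantDerivative I F V) (cW : CovariantDerivative I F' W)
    {u : Π x, V x →L[ℝ] W x} {x : M}
    (hu : MDiffAt (fun y => TotalSpace.mk' (F →L[ℝ] F') (E := fun z => V z →L[ℝ] W z) y (u y)) x)
    (X : Π z : M, TangentSpace I z) :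
    TensorialAt I F (fun s : Π z : M, V z =>
      cW (fun y => u y (s y)) x (X x) - u x (cV s x (X x))) x where
  smul := by
    intro f s hf hs
    have h1 := congr($(cV.isCovariantDerivativeOnUniv.leibniz hs hf) (X x))
    have h2 := congr($(cW.isCovariantDerivativeOnUniv.leibniz (mdiff_app hu hs) hf) (X x))
    have h3 : (fun y => u y ((f • s) y)) = f • (fun y => u y (s y)) := by
      ext y; simp
    rw [h3, h1, h2]
    simp [smul_sub]
  add := by
    intro s t hs ht
    have h1 := congr($(cV.isCovariantDerivativeOnUniv.add hs ht) (X x))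
    have h2 := congr($(cW.isCovariantDerivativeOnUniv.add (mdiff_app hu hs)
      (mdiff_app hu ht)) (X x))
    have h3 : (fun y => u y ((s + t) y)) = (fun y => u y (s y)) + (fun y => u y (t y)) := by
      ext y; simp
    rw [h3, h1, h2]
    simp
    abel

/-- The bilinear map `(X, s) ↦ ∇_X (u s) - u (∇_X s)` at a point `x` where `u` is
differentiable. -/
def homCovAt (cV : CovariantDerivative I F V) (cW : CovariantDerivative I F' W)
    (u : Π x, V x →L[ℝ] W x) (x : M)
    (hu : MDiffAt (fun y => TotalSpace.mk' (F →L[ℝ] F') (E := fun z => V z →L[ℝ] W z) y (u y)) x) :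
    TangentSpace I x →L[ℝ] V x →L[ℝ] W x :=
  TensorialAt.mkHom₂ (I := I) (F := E) (F' := F) (V := fun z : M => TangentSpace I z) (V' := V)
    (fun X s => cW (fun y => u y (s y)) x (X x) - u x (cV s x (X x))) x
    (fun s _ => homCov_tensorial₁ cV cW u x s)
    (fun X _ => homCov_tensorial₂ cV cW hu X)

theorem homCovAt_extend (cV : CovariantDerivative I F V) (cW : CovariantDerivative I F' W)
    {u : Π x, V x →L[ℝ] W x} {x : M}
    (hu : MDiffAt (fun y => TotalSpace.mk' (F →L[ℝ] F') (E := fun z => V z →L[ℝ] W z) y (u y)) x)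
    (X : TangentSpace I x) (v : V x) :
    homCovAt cV cW u x hu X v
      = cW (fun y => u y (extend F v y)) x X - u x (cV (extend F v) x X) := by
  rw [homCovAt, TensorialAt.mkHom₂_apply_eq_extend]
  simp

open scoped Classical in
/-- The connection induced on `Hom(V, W)` by connections on `V` and `W`:
`(∇_X u)(s) = ∇_X (u s) - u (∇_X s)`, see `homCov_apply`.
(The value on sections not differentiable at the point is junk, set to `0`.) -/
def homCov (cV : CovariantDerivative I F V) (cW : CovariantDerivative I F' W) :
    CovariantDerivative I (F →L[ℝ] F') (fun x => V x →L[ℝ] W x) where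
  toFun u x :=
    if hu : MDiffAt (fun y => TotalSpace.mk' (F →L[ℝ] F') (E := fun z => V z →L[ℝ] W z) y (u y)) x
    then homCovAt cV cW u x hu
    else 0
  isCovariantDerivativeOnUniv :=
    { add := by
        intro u u' x hu hu' _
        have huu := mdifferentiableAt_add_section hu hu'
        rw [dif_pos hu, dif_pos hu', dif_pos huu]
        ext X v
        have he := mdifferentiableAt_extend I F v
        have h1 := congr($(cW.isCovariantDerivativeOnUniv.add (mdiff_app hu he)
          (mdiff_app hu' he)) X)
        have h2 := homCovAt_extend cV cW huu X v
        have h3 : (fun y => (u + u') y (extend F v y))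
          = (fun y => u y (extend F v y)) + (fun y => u' y (extend F v y)) := by
          ext y; simp
        rw [h3, h1] at h2
        refine h2.trans ?_
        simp only [add_apply, Pi.add_apply, homCovAt_extend]
        abel
      leibniz := by
        intro u g x hu hg _
        have hgu := hg.smul_section hu
        rw [dif_pos hu, dif_pos hgu]
        ext X v
        have he := mdifferentiableAt_extend I F v
        have h1 := congr($(cW.isCovariantDerivativeOnUniv.leibniz (mdiff_app hu he) hg) X)
        have h2 := homCovAt_extend cV cW hgu X v
        have h3 : (fun y => (g • u) y (extend F v y)) = g • (fun y => u y (extend F v y)) := by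
          ext y; simp
        have h4 := homCovAt_extend cV cW hu X v
        refine h2.trans ?_
        rw [h3, h1]
        simp only [add_apply, smul_apply, h4,
          ContinuousLinearMap.smulRight_apply, extend_apply_self, Pi.smul_apply', smul_sub]
        abel }

theorem homCov_apply (cV : CovariantDerivative I F V) (cW : CovariantDerivative I F' W)
    {u : Π x, V x →L[ℝ] W x} {s : Π x, V x} {x : M}
    (hu : MDiffAt (fun y => TotalSpace.mk' (F →L[ℝ] F') (E := fun z => V z →L[ℝ] W z) y (u y)) x)
    (hs : MDiffAt (fun y => TotalSpace.mk' F y (s y)) x) (X : TangentSpace I x) :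
    homCov cV cW u x X (s x) = cW (fun y => u y (s y)) x X - u x (cV s x X) := by
  have h0 : homCov cV cW u x = homCovAt cV cW u x hu := dif_pos hu
  rw [h0]
  have h := TensorialAt.mkHom₂_apply (I := I) (F := E) (F' := F)
    (V := fun z : M => TangentSpace I z) (V' := V)
    (Φ := fun X s => cW (fun y => u y (s y)) x (X x) - u x (cV s x (X x))) (x := x)
    (fun s _ => homCov_tensorial₁ cV cW u x s)
    (fun X _ => homCov_tensorial₂ cV cW hu X) (mdifferentiableAt_extend I E X) hs
  rw [extend_apply_self] at h
  exact h

end Connections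

section Structures

variable {E : Type*} [NormedAddCommGroup E] [NormedSpace ℝ E]
  {H : Type*} [TopologicalSpace H] {I : ModelWithCorners ℝ E H}
  {M : Type*} [TopologicalSpace M] [ChartedSpace H M]

/-! ### Endomorphism fields -/

section Endo

variable {F : Type*} [NormedAddCommGroup F] [NormedSpace ℝ F]
  {V : M → Type*} [TopologicalSpace (TotalSpace F V)]
  [∀ x, AddCommGroup (V x)] [∀ x, Module ℝ (V x)] [∀ x, TopologicalSpace (V x)]
  [∀ x, IsTopologicalAddGroup (V x)] [∀ x, ContinuousSMul ℝ (V x)]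
  [FiberBundle F V] [VectorBundle ℝ F V]

variable (I F) in
/-- The field of endomorphisms `u` of the vector bundle `V` is smooth on `U`. -/
def SmoothEndOn (u : Π x, V x →L[ℝ] V x) (U : Set M) : Prop :=
  ContMDiffOn I (I.prod 𝓘(ℝ, F →L[ℝ] F)) ∞
    (fun y => TotalSpace.mk' (F →L[ℝ] F) (E := fun z => V z →L[ℝ] V z) y (u y)) U

variable (I F) in
/-- `D` is a rank three subbundle of `End V` which, near every point, is spanned by a smooth triple
`J₁, J₂, J₁ J₂`, where `J₁, J₂` square to `-1`, anticommute and satisfy the pointwise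
compatibility condition `P`. -/
def IsQuaternionicBundle (P : ∀ x, (V x →L[ℝ] V x) → Prop)
    (D : Π x : M, Submodule ℝ (V x →L[ℝ] V x)) : Prop :=
  ∀ x₀ : M, ∃ U : Set M, IsOpen U ∧ x₀ ∈ U ∧ ∃ J₁ J₂ : Π x, V x →L[ℝ] V x,
    SmoothEndOn I F J₁ U ∧ SmoothEndOn I F J₂ U ∧ ∀ y ∈ U,
      P y (J₁ y) ∧ P y (J₂ y) ∧
      J₁ y * J₁ y = -1 ∧ J₂ y * J₂ y = -1 ∧ J₁ y * J₂ y = -(J₂ y * J₁ y) ∧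
      D y = Submodule.span ℝ {J₁ y, J₂ y, J₁ y * J₂ y} ∧ Module.finrank ℝ (D y) = 3

variable (F) in
/-- `∇ D ⊆ D`: the connection `c` on `End V` maps local smooth sections of `D` to sections
of `D`. -/
def IsStable (c : CovariantDerivative I (F →L[ℝ] F) (fun x => V x →L[ℝ] V x))
    (D : Π x : M, Submodule ℝ (V x →L[ℝ] V x)) : Prop :=
  ∀ (U : Set M) (u : Π x, V x →L[ℝ] V x), IsOpen U → SmoothEndOn I F u U →
    (∀ y ∈ U, u y ∈ D y) → ∀ x ∈ U, ∀ X : TangentSpace I x, c u x X ∈ D x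

open scoped Classical in
/-- The image `f(u)` under `f : D → D'` of a field of endomorphisms `u`, at the points where `u`
takes its values in `D` (and `0` elsewhere). -/
def applyIso {D D' : Π x : M, Submodule ℝ (V x →L[ℝ] V x)} (f : Π x, D x ≃ₗ[ℝ] D' x)
    (u : Π x, V x →L[ℝ] V x) : Π x, V x →L[ℝ] V x :=
  fun x => if h : u x ∈ D x then (f x ⟨u x, h⟩ : V x →L[ℝ] V x) else 0

end Endo

/-! ### The generalized tangent bundle -/

variable (I) in
/-- The cotangent space at `x`. -/
abbrev Cotangent (x : M) : Type _ := TangentSpace I x →L[ℝ] Bundle.Trivial M ℝ x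

variable (I) in
/-- The fibre at `x` of the generalized tangent bundle `TM ⊕ T*M`. -/
abbrev GenTangent (x : M) : Type _ := TangentSpace I x × Cotangent I x

/-- The neutral pseudo-metric `⟨X + ξ, Y + η⟩ = (ξ(Y) + η(X)) / 2` on `TM ⊕ T*M`. -/
def pairing (x : M) (A B : GenTangent I x) : ℝ := (1 / 2) * (A.2 B.1 + B.2 A.1)

variable [FiniteDimensional ℝ E] [IsManifold I ∞ M]

/-- The connection on `T*M` induced by a connection on `TM`:
`(∇_X ξ)(Y) = X(ξ(Y)) - ξ(∇_X Y)`. -/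
def cotangentCov (c : CovariantDerivative I E (fun x : M => TangentSpace I x)) :
    CovariantDerivative I (E →L[ℝ] ℝ) (fun x : M => Cotangent I x) :=
  homCov c (trivialCov I M)

/-- The connection on `TM ⊕ T*M` induced by a connection on `TM`. -/
def genCov (c : CovariantDerivative I E (fun x : M => TangentSpace I x)) :
    CovariantDerivative I (E × (E →L[ℝ] ℝ)) (fun x : M => GenTangent I x) :=
  prodCov c (cotangentCov c)

variable (g : ContMDiffRiemannianMetric I ∞ E (fun x : M => TangentSpace I x))

/-- `c` is the Levi-Civita connection of `g`: it is metric and torsion free. -/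
def IsLeviCivita (c : CovariantDerivative I E (fun x : M => TangentSpace I x)) : Prop :=
  letI : RiemannianBundle (fun x : M => TangentSpace I x) := ⟨g.toRiemannianMetric⟩
  CovariantDerivative.IsMetricCompatible (F := E) (V := fun x : M => TangentSpace I x) c ∧
    c.torsion = 0

theorem isLeviCivita_iff (c : CovariantDerivative I E (fun x : M => TangentSpace I x)) :
    IsLeviCivita g c ↔
    (∀ (x : M) (Y Z : Π y : M, TangentSpace I y) (X : TangentSpace I x),
      MDifferentiableAt I (I.prod 𝓘(ℝ, E)) (fun y => TotalSpace.mk' E y (Y y)) x →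
      MDifferentiableAt I (I.prod 𝓘(ℝ, E)) (fun y => TotalSpace.mk' E y (Z y)) x →
      mvfderiv I (fun y => g.inner y (Y y) (Z y)) x X
        = g.inner x (c Y x X) (Z x) + g.inner x (Y x) (c Z x X)) ∧
    c.torsion = 0 := by
  let : RiemannianBundle (fun x : M => TangentSpace I x) := ⟨g.toRiemannianMetric⟩
  refine and_congr_left fun _ => ?_
  rw [CovariantDerivative.isMetricCompatible_iff]
  constructor
  · intro h x Y Z X hY hZ
    have := h (X := extend E X) (mdifferentiableAt_extend I E X) hY hZ
    simp only [extend_apply_self] at this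
    exact this
  · intro h x X Y Z hX hY hZ
    exact h x Y Z (X x) hY hZ

theorem inner_injective (x : M) : Function.Injective (g.inner x) := by
  rw [injective_iff_map_eq_zero]
  intro X hX
  by_contra h
  exact (g.pos x X h).ne' (by rw [hX]; rfl)

/-- The isomorphism `TM ≃ T*M`, `X ↦ g(X, ·)`. -/
def flat (x : M) : TangentSpace I x ≃ₗ[ℝ] Cotangent I x :=
  haveI : FiniteDimensional ℝ (TangentSpace I x) := inferInstanceAs (FiniteDimensional ℝ E)
  haveI : FiniteDimensional ℝ (Cotangent I x) := inferInstanceAs (FiniteDimensional ℝ (E →L[ℝ] ℝ))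
  LinearMap.linearEquivOfInjective (g.inner x).toLinearMap (inner_injective g x)
    ((Subspace.dual_finrank_eq (K := ℝ) (V := E)).symm.trans
      (LinearMap.toContinuousLinearMap (𝕜 := ℝ) (E := E) (F' := ℝ)).finrank_eq)

theorem flat_apply (x : M) (X Y : TangentSpace I x) : flat g x X Y = g.inner x X Y := rfl

/-- The extension of `g` to a metric on `TM ⊕ T*M`, where `T*M` carries the dual metric. -/
def genMetric (x : M) (A B : GenTangent I x) : ℝ :=
  g.inner x A.1 B.1 + g.inner x ((flat g x).symm A.2) ((flat g x).symm B.2)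

/-- Almost quaternionic Hermitian structures on `(M, g)`. -/
def IsAQH (D : Π x : M, Submodule ℝ (TangentSpace I x →L[ℝ] TangentSpace I x)) : Prop :=
  IsQuaternionicBundle I E
    (fun x J => ∀ X Y : TangentSpace I x, g.inner x (J X) (J Y) = g.inner x X Y) D

/-- Generalized almost quaternionic Hermitian structures on `(M, g)`. -/
def IsGenAQH (D : Π x : M, Submodule ℝ (GenTangent I x →L[ℝ] GenTangent I x)) : Prop :=
  IsQuaternionicBundle I (E × (E →L[ℝ] ℝ))
    (fun x J => (∀ A B : GenTangent I x, pairing x (J A) (J B) = pairing x A B) ∧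
      ∀ A B : GenTangent I x, genMetric g x (J A) (J B) = genMetric g x A B) D

/-- Quaternionic Kähler structures on `(M, g)`: almost quaternionic Hermitian structures stable
under the connection `c` (to be taken as the Levi-Civita connection of `g`). -/
def IsQK (c : CovariantDerivative I E (fun x : M => TangentSpace I x))
    (D : Π x : M, Submodule ℝ (TangentSpace I x →L[ℝ] TangentSpace I x)) : Prop :=
  IsAQH g D ∧ IsStable E (homCov c c) D

/-- Generalized quaternionic Kähler structures on `(M, g)`: generalized almost quaternionic
Hermitian structures stable under the connection `c` (to be taken as the Levi-Civita connection
of `g`) extended to `TM ⊕ T*M`. -/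
def IsGenQK (c : CovariantDerivative I E (fun x : M => TangentSpace I x))
    (D : Π x : M, Submodule ℝ (GenTangent I x →L[ℝ] GenTangent I x)) : Prop :=
  IsGenAQH g D ∧ IsStable (E × (E →L[ℝ] ℝ)) (homCov (genCov c) (genCov c)) D

/-! ### The two halves of a generalized structure

Let `G` be the involution `X + ξ ↦ g⁻¹ξ + gX` of `TM ⊕ T*M`. Its eigenbundles for the eigenvalues
`ε = 1` and `ε = -1` are `C^ε = {X + ε g(X, ·)}`, and the projection `p^ε : C^ε → TM` is an
isomorphism, with inverse `X ↦ X + ε g(X, ·)`. -/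

/-- The involution `G(X + ξ) = g⁻¹ξ + gX`. -/
def genInvol (x : M) (A : GenTangent I x) : GenTangent I x := ((flat g x).symm A.2, flat g x A.1)

/-- The inverse `X ↦ X + ε g(X, ·)` of the projection `p^ε : C^ε → TM`. -/
def lift (x : M) (ε : ℝ) : TangentSpace I x →L[ℝ] GenTangent I x :=
  (ContinuousLinearMap.id ℝ (TangentSpace I x)).prod (ε • g.inner x)

theorem mem_range_lift (x : M) {ε : ℝ} (hε : ε = 1 ∨ ε = -1) (A : GenTangent I x) :
    A ∈ Set.range (lift g x ε) ↔ genInvol g x A = ε • A := by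
  have key : ∀ X : TangentSpace I x, lift g x ε X = (X, ε • flat g x X) := fun _ => rfl
  obtain ⟨X, ξ⟩ := A
  simp only [Set.mem_range, key, genInvol, Prod.smul_mk, Prod.mk.injEq]
  constructor
  · rintro ⟨Y, rfl, rfl⟩
    rcases hε with rfl | rfl <;> simp [smul_smul]
  · rintro ⟨-, h⟩
    refine ⟨X, rfl, ?_⟩
    rw [h, smul_smul]
    rcases hε with rfl | rfl <;> simp

/-- The endomorphism `u^ε = p^ε ∘ u ∘ (p^ε)⁻¹` of `TM` induced by an endomorphism `u` of
`TM ⊕ T*M` (which is meant to preserve `C^ε`). -/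
def part (x : M) (ε : ℝ) :
    (GenTangent I x →L[ℝ] GenTangent I x) →ₗ[ℝ] (TangentSpace I x →L[ℝ] TangentSpace I x) where
  toFun u := (ContinuousLinearMap.fst ℝ (TangentSpace I x) (Cotangent I x)).comp
    (u.comp (lift g x ε))
  map_add' u v := by ext X; simp
  map_smul' r u := by ext X; simp

/-- A pair of almost quaternionic Hermitian structures `Dm = D⁻`, `Dp = D⁺` on `(M, g)` with an
algebra isomorphism `f : D⁻ → D⁺`, that is a smooth isomorphism of vector bundles which extends to
a fibrewise isomorphism between the algebras `D⁻ ⊕ Vect(Id)` and `D⁺ ⊕ Vect(Id)` generated by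
`D⁻` and `D⁺`. -/
structure QuatPair where
  Dm : Π x : M, Submodule ℝ (TangentSpace I x →L[ℝ] TangentSpace I x)
  Dp : Π x : M, Submodule ℝ (TangentSpace I x →L[ℝ] TangentSpace I x)
  isAQH_Dm : IsAQH g Dm
  isAQH_Dp : IsAQH g Dp
  f : Π x, Dm x ≃ₗ[ℝ] Dp x
  smooth : ∀ (U : Set M) (u : Π x : M, TangentSpace I x →L[ℝ] TangentSpace I x), IsOpen U →
    SmoothEndOn I E u U → (∀ y ∈ U, u y ∈ Dm y) → SmoothEndOn I E (applyIso f u) U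
  isAlg : ∀ x, ∃ φ : Algebra.adjoin ℝ (Dm x : Set (TangentSpace I x →L[ℝ] TangentSpace I x)) ≃ₐ[ℝ]
      Algebra.adjoin ℝ (Dp x : Set (TangentSpace I x →L[ℝ] TangentSpace I x)),
    ∀ (u : TangentSpace I x →L[ℝ] TangentSpace I x) (hu : u ∈ Dm x),
      (φ ⟨u, Algebra.subset_adjoin hu⟩ : TangentSpace I x →L[ℝ] TangentSpace I x) = f x ⟨u, hu⟩

variable {g}

/-- The condition `∇ f(u) = f(∇ u)` for all local smooth sections `u` of `D⁻`. -/
def QuatPair.IsParallel (p : QuatPair g)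
    (c : CovariantDerivative I E (fun x : M => TangentSpace I x)) : Prop :=
  ∀ (U : Set M) (u : Π x : M, TangentSpace I x →L[ℝ] TangentSpace I x), IsOpen U →
    SmoothEndOn I E u U → (∀ y ∈ U, u y ∈ p.Dm y) → ∀ x ∈ U, ∀ X : TangentSpace I x,
      ∃ h : homCov c c u x X ∈ p.Dm x,
        homCov c c (applyIso p.f u) x X = p.f x ⟨homCov c c u x X, h⟩

/-- `p` is the pair `(D⁻, D⁺, f)` induced by `D`: the elements `u` of `D` preserve
`C⁺` and `C⁻`, one has `D^± = {u^± | u ∈ D}`, and `f` is the map `u⁻ ↦ u⁺`. -/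
def QuatPair.IsInducedBy (p : QuatPair g)
    (D : Π x : M, Submodule ℝ (GenTangent I x →L[ℝ] GenTangent I x)) : Prop :=
  ∀ x, p.Dp x = (D x).map (part g x 1) ∧ p.Dm x = (D x).map (part g x (-1)) ∧
    ∀ u ∈ D x,
      (∀ X : TangentSpace I x, u (lift g x 1 X) = lift g x 1 (part g x 1 u X)) ∧
      (∀ X : TangentSpace I x, u (lift g x (-1) X) = lift g x (-1) (part g x (-1) u X)) ∧
      ∃ h : part g x (-1) u ∈ p.Dm x,
        (p.f x ⟨part g x (-1) u, h⟩ : TangentSpace I x →L[ℝ] TangentSpace I x) = part g x 1 u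

end Structures

end GenQuat

end

open Bundle FiberBundle
open scoped Manifold ContDiff Topology

noncomputable section

/-! Under `TM ⊕ T*M = C⁺ ⊕ C⁻`, with each summand identified with `TM`, the metric becomes `2g ⊕ 2g`
and the pseudo-metric `g ⊕ (-g)` (`genMetric_eq`, `pairing_eq`). An invertible map preserving both
forms therefore cannot mix the summands (`preservesHalves_of_isometry`), so an element `u` of a
generalized structure `D` amounts to the pair `(u⁻, u⁺)`.

If `i, j` is a local quaternionic frame of `D`, then `i^ε, j^ε` is one of `D^ε`, with the same
coordinates for `u^ε` as for `u`. The coordinates of an imaginary quaternion are recovered by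
anticommutators with the frame. Hence `u ↦ u^ε` is injective on `D`, and sections of `D`, `D⁻`, `D⁺`
that correspond to each other are smooth together (`SmoothEndOn.of_imComb`). So `u⁻ ↦ u⁺` is a
smooth isomorphism. It is one of algebras because both generated algebras are copies of the
quaternions (`exists_algEquiv`).

Conversely a triple `(D⁻, D⁺, f)` gives the bundle of block endomorphisms `(u, f(u))`
(`isGenAQH_genBundle`). The two constructions are inverse to each other, since `D` consists exactly
of the endomorphisms preserving both halves whose parts are related by `f` (`mem_iff`).

For the second claim, a metric connection commutes with `X ↦ X + ε g(X, ·)` (`genCov_lift`), so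
`(∇u)^ε = ∇(u^ε)` (`part_homCov`). By the same description of `D`, `∇u` lies in `D` exactly when
`∇u⁻` lies in `D⁻` and `f(∇u⁻) = ∇f(u⁻)`. -/

namespace GenQuat

set_option linter.unusedSectionVars false

/-! ### Smooth fields of homomorphisms between vector bundles -/

section SmoothHom

variable {E : Type*} [NormedAddCommGroup E] [NormedSpace ℝ E]
  {H : Type*} [TopologicalSpace H] {I : ModelWithCorners ℝ E H}
  {M : Type*} [TopologicalSpace M] [ChartedSpace H M]
  {F₁ : Type*} [NormedAddCommGroup F₁] [NormedSpace ℝ F₁]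
  {V₁ : M → Type*} [TopologicalSpace (TotalSpace F₁ V₁)]
  [∀ x, AddCommGroup (V₁ x)] [∀ x, Module ℝ (V₁ x)] [∀ x, TopologicalSpace (V₁ x)]
  [∀ x, IsTopologicalAddGroup (V₁ x)] [∀ x, ContinuousSMul ℝ (V₁ x)]
  [FiberBundle F₁ V₁] [VectorBundle ℝ F₁ V₁]
  {F₂ : Type*} [NormedAddCommGroup F₂] [NormedSpace ℝ F₂]
  {V₂ : M → Type*} [TopologicalSpace (TotalSpace F₂ V₂)]
  [∀ x, AddCommGroup (V₂ x)] [∀ x, Module ℝ (V₂ x)] [∀ x, TopologicalSpace (V₂ x)]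
  [∀ x, IsTopologicalAddGroup (V₂ x)] [∀ x, ContinuousSMul ℝ (V₂ x)]
  [FiberBundle F₂ V₂] [VectorBundle ℝ F₂ V₂]
  {F₃ : Type*} [NormedAddCommGroup F₃] [NormedSpace ℝ F₃]
  {V₃ : M → Type*} [TopologicalSpace (TotalSpace F₃ V₃)]
  [∀ x, AddCommGroup (V₃ x)] [∀ x, Module ℝ (V₃ x)] [∀ x, TopologicalSpace (V₃ x)]
  [∀ x, IsTopologicalAddGroup (V₃ x)] [∀ x, ContinuousSMul ℝ (V₃ x)]
  [FiberBundle F₃ V₃] [VectorBundle ℝ F₃ V₃]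

variable (I F₁ F₂) in
/-- The field of homomorphisms `u` from `V₁` to `V₂` is smooth on `U`. -/
def SmoothHomOn (u : Π x, V₁ x →L[ℝ] V₂ x) (U : Set M) : Prop :=
  ContMDiffOn I (I.prod 𝓘(ℝ, F₁ →L[ℝ] F₂)) ∞
    (fun y => TotalSpace.mk' (F₁ →L[ℝ] F₂) (E := fun z => V₁ z →L[ℝ] V₂ z) y (u y)) U

variable (F₁ F₂) in
/-- The expression of `u x` in the preferred trivializations at `x₀`. -/
def coord (u : Π x, V₁ x →L[ℝ] V₂ x) (x₀ x : M) : F₁ →L[ℝ] F₂ :=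
  ContinuousLinearMap.inCoordinates F₁ V₁ F₂ V₂ x₀ x x₀ x (u x)

variable (V₁ F₁) in
theorem mem_baseSet_nhds (x₀ : M) : ∀ᶠ x in 𝓝 x₀, x ∈ (trivializationAt F₁ V₁ x₀).baseSet :=
  (trivializationAt F₁ V₁ x₀).open_baseSet.mem_nhds (mem_baseSet_trivializationAt F₁ V₁ x₀)

/-- Trivializations centred at `x₀` turn smoothness at `x₀` into smoothness of a map into a fixed
normed space. The closure properties below under composition, product and inversion are obtained
there. -/
theorem smoothHomOn_iff {u : Π x, V₁ x →L[ℝ] V₂ x} {U : Set M} (hU : IsOpen U) :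
    SmoothHomOn I F₁ F₂ u U ↔
      ∀ x₀ ∈ U, ContMDiffAt I 𝓘(ℝ, F₁ →L[ℝ] F₂) ∞ (coord F₁ F₂ u x₀) x₀ := by
  refine forall₂_congr fun x₀ hx₀ => ?_
  rw [contMDiffWithinAt_hom_bundle]
  have h : ContMDiffWithinAt I I ∞ (fun x : M => x) U x₀ := contMDiffWithinAt_id
  refine (and_iff_right h).trans ?_
  exact ⟨fun h => h.contMDiffAt (hU.mem_nhds hx₀), fun h => h.contMDiffWithinAt⟩

theorem coord_apply {u : Π x, V₁ x →L[ℝ] V₂ x} {x₀ x : M}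
    (h₁ : x ∈ (trivializationAt F₁ V₁ x₀).baseSet) (h₂ : x ∈ (trivializationAt F₂ V₂ x₀).baseSet) :
    coord F₁ F₂ u x₀ x =
      ((trivializationAt F₂ V₂ x₀).continuousLinearEquivAt ℝ x h₂ : V₂ x →L[ℝ] F₂) ∘L u x ∘L
        (((trivializationAt F₁ V₁ x₀).continuousLinearEquivAt ℝ x h₁).symm : F₁ →L[ℝ] V₁ x) :=
  ContinuousLinearMap.inCoordinates_eq h₁ h₂

theorem SmoothHomOn.comp {u : Π x, V₁ x →L[ℝ] V₂ x} {v : Π x, V₂ x →L[ℝ] V₃ x} {U : Set M}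
    (hU : IsOpen U) (hv : SmoothHomOn I F₂ F₃ v U) (hu : SmoothHomOn I F₁ F₂ u U) :
    SmoothHomOn I F₁ F₃ (fun x => v x ∘L u x) U := by
  rw [smoothHomOn_iff hU] at *
  intro x₀ hx₀
  refine ((hv x₀ hx₀).clm_comp (hu x₀ hx₀)).congr_of_eventuallyEq ?_
  filter_upwards [mem_baseSet_nhds F₁ V₁ x₀, mem_baseSet_nhds F₂ V₂ x₀,
    mem_baseSet_nhds F₃ V₃ x₀] with x h₁ h₂ h₃
  rw [coord_apply h₁ h₃, coord_apply h₂ h₃, coord_apply h₁ h₂]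
  refine ContinuousLinearMap.ext fun w => ?_
  simp only [ContinuousLinearMap.comp_apply, ContinuousLinearEquiv.coe_coe,
    ContinuousLinearEquiv.symm_apply_apply]

theorem SmoothHomOn.add {u v : Π x, V₁ x →L[ℝ] V₂ x} {U : Set M}
    (hu : SmoothHomOn I F₁ F₂ u U) (hv : SmoothHomOn I F₁ F₂ v U) :
    SmoothHomOn I F₁ F₂ (fun x => u x + v x) U :=
  ContMDiffOn.add_section hu hv

theorem SmoothHomOn.const_smul {u : Π x, V₁ x →L[ℝ] V₂ x} {U : Set M} (r : ℝ)
    (hu : SmoothHomOn I F₁ F₂ u U) : SmoothHomOn I F₁ F₂ (fun x => r • u x) U :=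
  ContMDiffOn.const_smul_section hu

theorem SmoothHomOn.mono {u : Π x, V₁ x →L[ℝ] V₂ x} {U U' : Set M}
    (hu : SmoothHomOn I F₁ F₂ u U) (h : U' ⊆ U) : SmoothHomOn I F₁ F₂ u U' :=
  ContMDiffOn.mono hu h

theorem SmoothHomOn.congr {u v : Π x, V₁ x →L[ℝ] V₂ x} {U : Set M}
    (hu : SmoothHomOn I F₁ F₂ u U) (h : ∀ x ∈ U, v x = u x) : SmoothHomOn I F₁ F₂ v U :=
  ContMDiffOn.congr hu fun x hx => by rw [h x hx]

theorem SmoothHomOn.of_locally {u : Π x, V₁ x →L[ℝ] V₂ x} {U : Set M}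
    (h : ∀ x ∈ U, ∃ U', IsOpen U' ∧ x ∈ U' ∧ SmoothHomOn I F₁ F₂ u (U ∩ U')) :
    SmoothHomOn I F₁ F₂ u U :=
  contMDiffOn_of_locally_contMDiffOn h

/-- Serves the tautological bundle maps (identity, projections of a direct sum), whose matrix is the
same constant in every trivialization. -/
theorem smoothHomOn_of_coord_eq {u : Π x, V₁ x →L[ℝ] V₂ x} {U : Set M} (hU : IsOpen U)
    (c : F₁ →L[ℝ] F₂)
    (h : ∀ x₀ x, x ∈ (trivializationAt F₁ V₁ x₀).baseSet → x ∈ (trivializationAt F₂ V₂ x₀).baseSet →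
      coord F₁ F₂ u x₀ x = c) : SmoothHomOn I F₁ F₂ u U := by
  rw [smoothHomOn_iff hU]
  intro x₀ _
  refine (contMDiffAt_const (c := c)).congr_of_eventuallyEq ?_
  filter_upwards [mem_baseSet_nhds F₁ V₁ x₀, mem_baseSet_nhds F₂ V₂ x₀] with x h₁ h₂
    using h x₀ x h₁ h₂

theorem smoothHomOn_id {U : Set M} (hU : IsOpen U) :
    SmoothHomOn I F₁ F₁ (fun x => ContinuousLinearMap.id ℝ (V₁ x)) U := by
  refine smoothHomOn_of_coord_eq hU (ContinuousLinearMap.id ℝ F₁) fun x₀ x h₁ h₂ => ?_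
  rw [coord_apply h₁ h₂]
  exact ContinuousLinearMap.ext fun w =>
    ((trivializationAt F₁ V₁ x₀).continuousLinearEquivAt ℝ x h₁).apply_symm_apply w

theorem continuousLinearEquivAt_prod_apply {x₀ x : M}
    (h : x ∈ (trivializationAt (F₁ × F₂) (V₁ ×ᵇ V₂) x₀).baseSet) (A : V₁ x × V₂ x) :
    (trivializationAt (F₁ × F₂) (V₁ ×ᵇ V₂) x₀).continuousLinearEquivAt ℝ x h A =
      ((trivializationAt F₁ V₁ x₀).continuousLinearEquivAt ℝ x h.1 A.1,
        (trivializationAt F₂ V₂ x₀).continuousLinearEquivAt ℝ x h.2 A.2) :=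
  DFunLike.congr_fun (Trivialization.continuousLinearEquivAt_prod h) A

theorem smoothHomOn_fst {U : Set M} (hU : IsOpen U) :
    SmoothHomOn I (F₁ × F₂) F₁ (V₁ := V₁ ×ᵇ V₂) (V₂ := V₁)
      (fun x => ContinuousLinearMap.fst ℝ (V₁ x) (V₂ x)) U := by
  refine smoothHomOn_of_coord_eq hU (ContinuousLinearMap.fst ℝ F₁ F₂) fun x₀ x h₁ h₂ => ?_
  rw [coord_apply h₁ h₂]
  refine ContinuousLinearMap.ext fun w => ?_
  obtain ⟨A, rfl⟩ :=
    ((trivializationAt (F₁ × F₂) (V₁ ×ᵇ V₂) x₀).continuousLinearEquivAt ℝ x h₁).surjective w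
  have h := congrArg Prod.fst (continuousLinearEquivAt_prod_apply h₁ A)
  refine Eq.trans ?_ h.symm
  exact congrArg (fun B : V₁ x × V₂ x =>
      (trivializationAt F₁ V₁ x₀).continuousLinearEquivAt ℝ x h₂ B.1)
    (ContinuousLinearEquiv.symm_apply_apply _ A)

theorem smoothHomOn_snd {U : Set M} (hU : IsOpen U) :
    SmoothHomOn I (F₁ × F₂) F₂ (V₁ := V₁ ×ᵇ V₂) (V₂ := V₂)
      (fun x => ContinuousLinearMap.snd ℝ (V₁ x) (V₂ x)) U := by
  refine smoothHomOn_of_coord_eq hU (ContinuousLinearMap.snd ℝ F₁ F₂) fun x₀ x h₁ h₂ => ?_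
  rw [coord_apply h₁ h₂]
  refine ContinuousLinearMap.ext fun w => ?_
  obtain ⟨A, rfl⟩ :=
    ((trivializationAt (F₁ × F₂) (V₁ ×ᵇ V₂) x₀).continuousLinearEquivAt ℝ x h₁).surjective w
  have h := congrArg Prod.snd (continuousLinearEquivAt_prod_apply h₁ A)
  refine Eq.trans ?_ h.symm
  exact congrArg (fun B : V₁ x × V₂ x =>
      (trivializationAt F₂ V₂ x₀).continuousLinearEquivAt ℝ x h₂ B.2)
    (ContinuousLinearEquiv.symm_apply_apply _ A)

theorem SmoothHomOn.prod {u : Π x, V₃ x →L[ℝ] V₁ x} {v : Π x, V₃ x →L[ℝ] V₂ x} {U : Set M}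
    (hU : IsOpen U) (hu : SmoothHomOn I F₃ F₁ u U) (hv : SmoothHomOn I F₃ F₂ v U) :
    SmoothHomOn I F₃ (F₁ × F₂) (V₂ := V₁ ×ᵇ V₂) (fun x => (u x).prod (v x)) U := by
  rw [smoothHomOn_iff hU] at *
  intro x₀ hx₀
  have h : ContMDiffAt I 𝓘(ℝ, F₃ →L[ℝ] F₁ × F₂) ∞
      (fun x => (coord F₃ F₁ u x₀ x).prod (coord F₃ F₂ v x₀ x)) x₀ :=
    (ContinuousLinearMap.prodₗᵢ (𝕜 := ℝ) (E := F₃) (F := F₁) (G := F₂)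
      ℝ).toContinuousLinearEquiv.contDiff.contDiffAt.contMDiffAt.comp x₀
        ((hu x₀ hx₀).prodMk_space (hv x₀ hx₀))
  refine h.congr_of_eventuallyEq ?_
  filter_upwards [mem_baseSet_nhds F₁ V₁ x₀, mem_baseSet_nhds F₂ V₂ x₀,
    mem_baseSet_nhds F₃ V₃ x₀] with x h₁ h₂ h₃
  have h₁₂ : x ∈ (trivializationAt (F₁ × F₂) (V₁ ×ᵇ V₂) x₀).baseSet := ⟨h₁, h₂⟩
  rw [coord_apply h₃ h₁₂, coord_apply h₃ h₁, coord_apply h₃ h₂]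
  exact ContinuousLinearMap.ext fun w => continuousLinearEquivAt_prod_apply h₁₂ _

/-- The coordinates of the inverse are the inverse of the coordinates, and inversion of operators is
smooth at an invertible operator on a complete space. -/
theorem SmoothHomOn.inverse [CompleteSpace F₁] {u : Π x, V₁ x ≃L[ℝ] V₂ x} {U : Set M}
    (hU : IsOpen U) (hu : SmoothHomOn I F₁ F₂ (fun x => (u x : V₁ x →L[ℝ] V₂ x)) U) :
    SmoothHomOn I F₂ F₁ (fun x => ((u x).symm : V₂ x →L[ℝ] V₁ x)) U := by
  rw [smoothHomOn_iff hU] at *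
  intro x₀ hx₀
  have key : ∀ x (h₁ : x ∈ (trivializationAt F₁ V₁ x₀).baseSet)
      (h₂ : x ∈ (trivializationAt F₂ V₂ x₀).baseSet), ∃ e : F₁ ≃L[ℝ] F₂,
      coord F₁ F₂ (fun x => (u x : V₁ x →L[ℝ] V₂ x)) x₀ x = e ∧
      coord F₂ F₁ (fun x => ((u x).symm : V₂ x →L[ℝ] V₁ x)) x₀ x = e.symm := by
    intro x h₁ h₂
    refine ⟨(((trivializationAt F₁ V₁ x₀).continuousLinearEquivAt ℝ x h₁).symm.trans (u x)).trans
      ((trivializationAt F₂ V₂ x₀).continuousLinearEquivAt ℝ x h₂), ?_, ?_⟩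
    · rw [coord_apply h₁ h₂]; rfl
    · rw [coord_apply h₂ h₁]; rfl
  obtain ⟨e, he, -⟩ := key x₀ (mem_baseSet_trivializationAt F₁ V₁ x₀)
    (mem_baseSet_trivializationAt F₂ V₂ x₀)
  have hinv := contDiffAt_map_inverse (n := ∞) e
  rw [← he] at hinv
  refine (hinv.contMDiffAt.comp x₀ (hu x₀ hx₀)).congr_of_eventuallyEq ?_
  filter_upwards [mem_baseSet_nhds F₁ V₁ x₀, mem_baseSet_nhds F₂ V₂ x₀] with x h₁ h₂
  obtain ⟨e', h, h'⟩ := key x h₁ h₂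
  simp [h, h']

end SmoothHom
-- Algebra of two anticommuting square roots of `-1`
section QuaternionicPairs

variable {A : Type*} [Ring A] [Algebra ℝ A] {B : Type*} [Ring B] [Algebra ℝ B]

/-- Two anticommuting square roots of `-1`. -/
structure IsQuatPair (i j : A) : Prop where
  sq_i : i * i = -1
  sq_j : j * j = -1
  anti : i * j = -(j * i)

/-- The imaginary quaternion with coordinates `a, b, c` in `i, j, i * j`. -/
def imComb (i j : A) (a b c : ℝ) : A := a • i + b • j + c • (i * j)

/-- The quaternions form a division ring. -/
theorem quaternion_algHom_injective [Nontrivial A] (f : Quaternion ℝ →ₐ[ℝ] A) :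
    Function.Injective f :=
  RingHom.injective (f : Quaternion ℝ →+* A)

namespace IsQuatPair

variable {i j : A} (h : IsQuatPair i j)
include h

/-- The quaternion basis associated with a pair. -/
def basis : QuaternionAlgebra.Basis A (-1 : ℝ) 0 (-1) where
  i := i
  j := j
  k := i * j
  i_mul_i := by simp [h.sq_i]
  j_mul_j := by simp [h.sq_j]
  i_mul_j := rfl
  j_mul_i := by simp [h.anti]

theorem j_mul_i : j * i = -(i * j) := by rw [h.anti, neg_neg]

/-- `i` anticommutes with `j` and `i * j`, so the anticommutator with `i` retains only the
`i`-component. This expresses a coordinate by ring operations alone, which gives both linear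
independence and smooth dependence of the coordinates. -/
theorem anticomm_left (a b c : ℝ) :
    (-(1 / 2) : ℝ) • (imComb i j a b c * i + i * imComb i j a b c) = a • (1 : A) := by
  have h1 : i * j * i = j := by rw [mul_assoc, h.j_mul_i, mul_neg, ← mul_assoc, h.sq_i]; simp
  have h2 : i * (i * j) = -j := by rw [← mul_assoc, h.sq_i]; simp
  simp only [imComb, add_mul, mul_add, smul_mul_assoc, mul_smul_comm, h1, h2, h.sq_i, h.j_mul_i]
  module

theorem anticomm_right (a b c : ℝ) :
    (-(1 / 2) : ℝ) • (imComb i j a b c * j + j * imComb i j a b c) = b • (1 : A) := by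
  have h1 : i * j * j = -i := by rw [mul_assoc, h.sq_j]; simp
  have h2 : j * (i * j) = i := by rw [← mul_assoc, h.j_mul_i, neg_mul, h1, neg_neg]
  simp only [imComb, add_mul, mul_add, smul_mul_assoc, mul_smul_comm, h1, h2, h.sq_j, h.j_mul_i]
  module

/-- The cyclic symmetry `i → j → k → i` makes the formula for the `k`-coordinate a case of
`anticomm_right`. -/
theorem rotate : IsQuatPair j (i * j) where
  sq_i := h.sq_j
  sq_j := by
    rw [mul_assoc, ← mul_assoc j, h.j_mul_i, neg_mul, mul_neg, mul_assoc i j j, h.sq_j]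
    simp [h.sq_i]
  anti := by
    rw [← mul_assoc, h.j_mul_i, neg_mul]

theorem imComb_rotate (a b c : ℝ) : imComb j (i * j) b c a = imComb i j a b c := by
  have : j * (i * j) = i := by
    rw [← mul_assoc, h.j_mul_i, neg_mul, mul_assoc, h.sq_j]; simp
  simp only [imComb, this]
  abel

theorem anticomm_mul (a b c : ℝ) :
    (-(1 / 2) : ℝ) • (imComb i j a b c * (i * j) + (i * j) * imComb i j a b c) = c • (1 : A) := by
  rw [← h.imComb_rotate]
  exact h.rotate.anticomm_right b c a

theorem imComb_eq_zero [Nontrivial A] {a b c : ℝ} (h0 : imComb i j a b c = 0) :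
    a = 0 ∧ b = 0 ∧ c = 0 := by
  have h1 := h.anticomm_left a b c
  have h2 := h.anticomm_right a b c
  have h3 := h.anticomm_mul a b c
  simp only [h0, zero_mul, mul_zero, add_zero, smul_zero, eq_comm (a := (0 : A)), smul_eq_zero,
    one_ne_zero, or_false] at h1 h2 h3
  exact ⟨h1, h2, h3⟩

theorem range_liftHom : h.basis.liftHom.range =
    Algebra.adjoin ℝ (Submodule.span ℝ {i, j, i * j} : Set A) := by
  rw [QuaternionAlgebra.Basis.range_liftHom, Algebra.adjoin_span]
  rfl

theorem liftHom_imag (a b c : ℝ) : h.basis.liftHom ⟨0, a, b, c⟩ = imComb i j a b c := by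
  simp [QuaternionAlgebra.Basis.lift, basis, imComb]

/-- Each generated algebra is the image of the quaternions under an injective homomorphism fixed by
its frame. The isomorphism goes back to the quaternions along one and forward along the other. -/
theorem exists_algEquiv [Nontrivial A] [Nontrivial B] {i' j' : B} (h' : IsQuatPair i' j')
    {D : Submodule ℝ A} {D' : Submodule ℝ B} (hD : D = Submodule.span ℝ {i, j, i * j})
    (hD' : D' = Submodule.span ℝ {i', j', i' * j'}) :
    ∃ φ : Algebra.adjoin ℝ (D : Set A) ≃ₐ[ℝ] Algebra.adjoin ℝ (D' : Set B),
      ∀ a b c hu, (φ ⟨imComb i j a b c, hu⟩ : B) = imComb i' j' a b c := by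
  subst hD hD'
  have inj : Function.Injective h.basis.liftHom :=
    quaternion_algHom_injective h.basis.liftHom
  have inj' : Function.Injective h'.basis.liftHom :=
    quaternion_algHom_injective h'.basis.liftHom
  refine ⟨(Subalgebra.equivOfEq _ _ h.range_liftHom).symm.trans
    ((AlgEquiv.ofInjective _ inj).symm.trans ((AlgEquiv.ofInjective _ inj').trans
      (Subalgebra.equivOfEq _ _ h'.range_liftHom))), fun a b c hu => ?_⟩
  -- The preimage is the purely imaginary quaternion with the same coordinates.
  have key : (AlgEquiv.ofInjective _ inj).symm
      ((Subalgebra.equivOfEq _ _ h.range_liftHom).symm ⟨imComb i j a b c, hu⟩) = ⟨0, a, b, c⟩ := by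
    rw [AlgEquiv.symm_apply_eq]
    exact Subtype.ext (h.liftHom_imag a b c).symm
  rw [AlgEquiv.trans_apply, AlgEquiv.trans_apply, key]
  exact h'.liftHom_imag a b c

end IsQuatPair

end QuaternionicPairs

/-! ### Coordinates in a spanned space of endomorphisms -/

section Endomorphisms

variable {T : Type*} [AddCommGroup T] [Module ℝ T] [TopologicalSpace T] [IsTopologicalAddGroup T]
  [ContinuousSMul ℝ T] {i j u v : T →L[ℝ] T} {D : Submodule ℝ (T →L[ℝ] T)}

theorem mem_iff_imComb (hD : D = Submodule.span ℝ {i, j, i * j}) :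
    u ∈ D ↔ ∃ a b c, imComb i j a b c = u := by
  rw [hD]
  exact Submodule.mem_span_triple

theorem end_sub_mem (hu : u ∈ D) (hv : v ∈ D) : u - v ∈ D :=
  D.sub_mem hu hv

end Endomorphisms
-- The splitting of `TM ⊕ T*M` into `C⁺` and `C⁻`
section Halves

set_option synthInstance.maxHeartbeats 200000

variable {E : Type*} [NormedAddCommGroup E] [NormedSpace ℝ E]
  {H : Type*} [TopologicalSpace H] {I : ModelWithCorners ℝ E H}
  {M : Type*} [TopologicalSpace M] [ChartedSpace H M]
  [FiniteDimensional ℝ E] [IsManifold I ∞ M]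
  (g : ContMDiffRiemannianMetric I ∞ E (fun x : M => TangentSpace I x))

/-- The isomorphism `X ↦ g(X, ·)` as a continuous linear equivalence. -/
def flatL (x : M) : TangentSpace I x ≃L[ℝ] Cotangent I x where
  toLinearEquiv := flat g x
  continuous_toFun := (g.inner x).continuous
  continuous_invFun :=
    haveI : FiniteDimensional ℝ (Cotangent I x) := inferInstanceAs (FiniteDimensional ℝ (E →L[ℝ] ℝ))
    haveI : T2Space (Cotangent I x) := inferInstanceAs (T2Space (E →L[ℝ] ℝ))
    LinearMap.continuous_of_finiteDimensional (flat g x).symm.toLinearMap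

theorem inner_flat_symm_left (x : M) (ξ : Cotangent I x) (Y : TangentSpace I x) :
    g.inner x ((flat g x).symm ξ) Y = ξ Y := by
  rw [← flat_apply, LinearEquiv.apply_symm_apply]

/-- The projection `A ↦ A^ε` onto `TM` along `C^{-ε}`, where `C^ε` is identified with `TM`. -/
def halfProj (x : M) (ε : ℝ) : GenTangent I x →L[ℝ] TangentSpace I x :=
  (1 / 2 : ℝ) • (ContinuousLinearMap.fst ℝ (TangentSpace I x) (Cotangent I x) +
    ε • ((flatL g x).symm : Cotangent I x →L[ℝ] TangentSpace I x) ∘L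
      ContinuousLinearMap.snd ℝ (TangentSpace I x) (Cotangent I x))

theorem halfProj_apply (x : M) (ε : ℝ) (A : GenTangent I x) :
    halfProj g x ε A = (1 / 2 : ℝ) • (A.1 + ε • (flat g x).symm A.2) := rfl

theorem lift_apply (x : M) (ε : ℝ) (X : TangentSpace I x) :
    lift g x ε X = (X, ε • flat g x X) := rfl

theorem part_apply (x : M) (ε : ℝ) (u : GenTangent I x →L[ℝ] GenTangent I x)
    (X : TangentSpace I x) : part g x ε u X = (u (lift g x ε X)).1 := rfl

/-- For signs, the factor is `1` when `ε = ε'` and `0` when `ε = -ε'`: one formula covers both the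
retraction and the vanishing on the other half. -/
theorem halfProj_lift (x : M) (ε ε' : ℝ) (X : TangentSpace I x) :
    halfProj g x ε (lift g x ε' X) = ((1 + ε * ε') / 2) • X := by
  rw [halfProj_apply, lift_apply]
  simp only [map_smul, LinearEquiv.symm_apply_apply]
  module

theorem lift_halfProj_add (x : M) (A : GenTangent I x) :
    lift g x 1 (halfProj g x 1 A) + lift g x (-1) (halfProj g x (-1) A) = A := by
  obtain ⟨X, ξ⟩ := A
  refine Prod.ext ?_ ?_
  · change (1 / 2 : ℝ) • (X + (1 : ℝ) • (flat g x).symm ξ) +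
      (1 / 2 : ℝ) • (X + (-1 : ℝ) • (flat g x).symm ξ) = X
    module
  · change (1 : ℝ) • flat g x ((1 / 2 : ℝ) • (X + (1 : ℝ) • (flat g x).symm ξ)) +
      (-1 : ℝ) • flat g x ((1 / 2 : ℝ) • (X + (-1 : ℝ) • (flat g x).symm ξ)) = ξ
    simp only [map_smul, map_add, LinearEquiv.apply_symm_apply]
    module

theorem genMetric_eq (x : M) (A B : GenTangent I x) : genMetric g x A B =
    2 * g.inner x (halfProj g x 1 A) (halfProj g x 1 B) +
      2 * g.inner x (halfProj g x (-1) A) (halfProj g x (-1) B) := by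
  simp only [halfProj_apply, genMetric, map_smul, map_add, smul_apply, add_apply, smul_eq_mul]
  ring

theorem pairing_eq (x : M) (A B : GenTangent I x) : pairing x A B =
    g.inner x (halfProj g x 1 A) (halfProj g x 1 B) -
      g.inner x (halfProj g x (-1) A) (halfProj g x (-1) B) := by
  simp only [halfProj_apply, pairing, map_smul, map_add, smul_apply, add_apply, smul_eq_mul,
    inner_flat_symm_left, g.symm x A.1 ((flat g x).symm B.2)]
  ring

/-- `u` preserves `C⁺` and `C⁻`. -/
def PreservesHalves (x : M) (u : GenTangent I x →L[ℝ] GenTangent I x) : Prop :=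
  ∀ ε : ℝ, ε = 1 ∨ ε = -1 → ∀ X, u (lift g x ε X) = lift g x ε (part g x ε u X)

variable {g}

theorem lift_halfProj_of_halfProj_neg_eq_zero {x : M} {ε : ℝ} (hε : ε = 1 ∨ ε = -1)
    {A : GenTangent I x} (h : halfProj g x (-ε) A = 0) : lift g x ε (halfProj g x ε A) = A := by
  have := lift_halfProj_add g x A
  rcases hε with rfl | rfl
  · rwa [h, map_zero, add_zero] at this
  · rw [neg_neg] at h
    rwa [h, map_zero, zero_add] at this

/-- The metric is `2ε` times the pseudo-metric as soon as one argument lies in `C^ε`. For `A ∈ C^ε`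
and `u B ∈ C^{-ε}`, this ratio is `2ε` at `(A, B)` and `-2ε` at `(u A, u B)`. As `u` preserves both
forms, they vanish there, so `u A` has no component in `C^{-ε}`. -/
theorem preservesHalves_of_isometry {x : M} {u : GenTangent I x →L[ℝ] GenTangent I x}
    (hp : ∀ A B : GenTangent I x, pairing x (u A) (u B) = pairing x A B)
    (hm : ∀ A B : GenTangent I x, genMetric g x (u A) (u B) = genMetric g x A B)
    (hsq : u * u = -1) : PreservesHalves g x u := by
  have hu : ∀ B, u (u B) = -B := fun B => DFunLike.congr_fun hsq B
  intro ε hε X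
  have hzero : halfProj g x (-ε) (u (lift g x ε X)) = 0 := by
    apply inner_injective g x
    ext Y
    -- `u` is onto because `u² = -1`, so every vector of `C^{-ε}` can be tested against.
    obtain ⟨B, hB⟩ : ∃ B, u B = lift g x (-ε) Y := ⟨-u (lift g x (-ε) Y), by simp [hu]⟩
    have h1 := hp (lift g x ε X) B
    have h2 := hm (lift g x ε X) B
    rw [hB] at h1 h2
    simp only [pairing_eq g, genMetric_eq, halfProj_lift] at h1 h2
    rcases hε with rfl | rfl
    · norm_num at h1 h2 ⊢
      linarith
    · norm_num at h1 h2 ⊢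
      linarith
  have h := lift_halfProj_of_halfProj_neg_eq_zero hε hzero
  rw [← h]
  congr 1
  rw [part_apply]
  exact congrArg Prod.fst h

theorem PreservesHalves.add {x : M} {u v : GenTangent I x →L[ℝ] GenTangent I x}
    (hu : PreservesHalves g x u) (hv : PreservesHalves g x v) : PreservesHalves g x (u + v) := by
  intro ε hε X
  rw [add_apply, hu ε hε, hv ε hε, map_add, add_apply, map_add]

theorem PreservesHalves.smul {x : M} {u : GenTangent I x →L[ℝ] GenTangent I x} (r : ℝ)
    (hu : PreservesHalves g x u) : PreservesHalves g x (r • u) := by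
  intro ε hε X
  rw [smul_apply, hu ε hε, map_smul, smul_apply, map_smul]

theorem part_mul {x : M} {u v : GenTangent I x →L[ℝ] GenTangent I x}
    (hv : PreservesHalves g x v) {ε : ℝ} (hε : ε = 1 ∨ ε = -1) :
    part g x ε (u * v) = part g x ε u * part g x ε v := by
  ext X
  change (u (v (lift g x ε X))).1 = (u (lift g x ε (part g x ε v X))).1
  rw [hv ε hε]

theorem part_one (x : M) (ε : ℝ) : part g x ε 1 = 1 := rfl

theorem PreservesHalves.mul {x : M} {u v : GenTangent I x →L[ℝ] GenTangent I x}
    (hu : PreservesHalves g x u) (hv : PreservesHalves g x v) : PreservesHalves g x (u * v) := by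
  intro ε hε X
  rw [part_mul hv hε]
  exact (congrArg u (hv ε hε X)).trans (hu ε hε _)

theorem PreservesHalves.inner_part {x : M} {u : GenTangent I x →L[ℝ] GenTangent I x}
    (hu : PreservesHalves g x u) {ε : ℝ} (hε : ε = 1 ∨ ε = -1) (X Y : TangentSpace I x)
    (hm : ∀ A B : GenTangent I x, genMetric g x (u A) (u B) = genMetric g x A B) :
    g.inner x (part g x ε u X) (part g x ε u Y) = g.inner x X Y := by
  have h := hm (lift g x ε X) (lift g x ε Y)
  rw [hu ε hε, hu ε hε] at h
  simp only [genMetric_eq, halfProj_lift] at h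
  rcases hε with rfl | rfl <;> norm_num at h ⊢ <;> exact h

variable (g) in
/-- The endomorphism of `TM ⊕ T*M` which is `a` on `C⁻` and `b` on `C⁺`. -/
def block (x : M) (a b : TangentSpace I x →L[ℝ] TangentSpace I x) :
    GenTangent I x →L[ℝ] GenTangent I x :=
  lift g x 1 ∘L b ∘L halfProj g x 1 + lift g x (-1) ∘L a ∘L halfProj g x (-1)

theorem block_apply (x : M) (a b : TangentSpace I x →L[ℝ] TangentSpace I x) (A : GenTangent I x) :
    block g x a b A = lift g x 1 (b (halfProj g x 1 A)) +
      lift g x (-1) (a (halfProj g x (-1) A)) := rfl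

theorem halfProj_one_block (x : M) (a b : TangentSpace I x →L[ℝ] TangentSpace I x)
    (A : GenTangent I x) : halfProj g x 1 (block g x a b A) = b (halfProj g x 1 A) := by
  rw [block_apply, map_add, halfProj_lift, halfProj_lift]
  norm_num

theorem halfProj_neg_one_block (x : M) (a b : TangentSpace I x →L[ℝ] TangentSpace I x)
    (A : GenTangent I x) : halfProj g x (-1) (block g x a b A) = a (halfProj g x (-1) A) := by
  rw [block_apply, map_add, halfProj_lift, halfProj_lift]
  norm_num

theorem block_lift_one (x : M) (a b : TangentSpace I x →L[ℝ] TangentSpace I x)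
    (X : TangentSpace I x) : block g x a b (lift g x 1 X) = lift g x 1 (b X) := by
  rw [block_apply, halfProj_lift, halfProj_lift]
  norm_num

theorem block_lift_neg_one (x : M) (a b : TangentSpace I x →L[ℝ] TangentSpace I x)
    (X : TangentSpace I x) : block g x a b (lift g x (-1) X) = lift g x (-1) (a X) := by
  rw [block_apply, halfProj_lift, halfProj_lift]
  norm_num

theorem part_one_block (x : M) (a b : TangentSpace I x →L[ℝ] TangentSpace I x) :
    part g x 1 (block g x a b) = b := by
  ext X
  rw [part_apply, block_lift_one]
  rfl

theorem part_neg_one_block (x : M) (a b : TangentSpace I x →L[ℝ] TangentSpace I x) :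
    part g x (-1) (block g x a b) = a := by
  ext X
  rw [part_apply, block_lift_neg_one]
  rfl

theorem preservesHalves_block (x : M) (a b : TangentSpace I x →L[ℝ] TangentSpace I x) :
    PreservesHalves g x (block g x a b) := by
  rintro ε (rfl | rfl) X
  · rw [block_lift_one, part_one_block]
  · rw [block_lift_neg_one, part_neg_one_block]

theorem PreservesHalves.ext {x : M} {u v : GenTangent I x →L[ℝ] GenTangent I x}
    (hu : PreservesHalves g x u) (hv : PreservesHalves g x v)
    (hm : part g x (-1) u = part g x (-1) v) (hp : part g x 1 u = part g x 1 v) : u = v := by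
  refine ContinuousLinearMap.ext fun A => ?_
  rw [← lift_halfProj_add g x A, map_add, map_add, hu 1 (.inl rfl), hu (-1) (.inr rfl),
    hv 1 (.inl rfl), hv (-1) (.inr rfl), hm, hp]

theorem block_mul (x : M) (a b a' b' : TangentSpace I x →L[ℝ] TangentSpace I x) :
    block g x a b * block g x a' b' = block g x (a * a') (b * b') := by
  refine PreservesHalves.ext (PreservesHalves.mul (preservesHalves_block _ _ _) (preservesHalves_block _ _ _))
    (preservesHalves_block _ _ _) ?_ ?_
  · rw [part_mul (preservesHalves_block _ _ _) (.inr rfl)]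
    simp only [part_neg_one_block]
  · rw [part_mul (preservesHalves_block _ _ _) (.inl rfl)]
    simp only [part_one_block]

theorem block_neg (x : M) (a b : TangentSpace I x →L[ℝ] TangentSpace I x) :
    block g x (-a) (-b) = -block g x a b := by
  refine ContinuousLinearMap.ext fun A => ?_
  rw [neg_apply, block_apply, block_apply, neg_apply, neg_apply, map_neg, map_neg]
  abel

theorem block_one (x : M) : block g x 1 1 = 1 :=
  ContinuousLinearMap.ext fun A => lift_halfProj_add g x A

/-- Both forms are block diagonal with blocks proportional to `g`, so isometric blocks suffice. -/
theorem block_isometry {x : M} {a b : TangentSpace I x →L[ℝ] TangentSpace I x}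
    (ha : ∀ X Y, g.inner x (a X) (a Y) = g.inner x X Y)
    (hb : ∀ X Y, g.inner x (b X) (b Y) = g.inner x X Y) :
    (∀ A B : GenTangent I x, pairing x (block g x a b A) (block g x a b B) = pairing x A B) ∧
      ∀ A B : GenTangent I x,
        genMetric g x (block g x a b A) (block g x a b B) = genMetric g x A B := by
  constructor <;> intro A B
  · simp only [pairing_eq g, halfProj_one_block, halfProj_neg_one_block, ha, hb]
  · simp only [genMetric_eq, halfProj_one_block, halfProj_neg_one_block, ha, hb]

end Halves
-- Smoothness of the splitting
section SmoothHalves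

set_option synthInstance.maxHeartbeats 200000

variable {E : Type*} [NormedAddCommGroup E] [NormedSpace ℝ E]
  {H : Type*} [TopologicalSpace H] {I : ModelWithCorners ℝ E H}
  {M : Type*} [TopologicalSpace M] [ChartedSpace H M]
  [FiniteDimensional ℝ E] [IsManifold I ∞ M]
  (g : ContMDiffRiemannianMetric I ∞ E (fun x : M => TangentSpace I x))

theorem smooth_flat (U : Set M) :
    SmoothHomOn I E (E →L[ℝ] ℝ) (V₁ := fun x : M => TangentSpace I x)
      (V₂ := fun x : M => Cotangent I x) (fun x => g.inner x) U :=
  g.contMDiff.contMDiffOn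

theorem smooth_sharp {U : Set M} (hU : IsOpen U) :
    SmoothHomOn I (E →L[ℝ] ℝ) E (V₁ := fun x : M => Cotangent I x)
      (V₂ := fun x : M => TangentSpace I x) (fun x => ((flatL g x).symm : _ →L[ℝ] _)) U := by
  have := FiniteDimensional.complete ℝ E
  exact SmoothHomOn.inverse (V₁ := fun x : M => TangentSpace I x)
    (V₂ := fun x : M => Cotangent I x) (u := fun x => flatL g x) hU (smooth_flat g U)

theorem smooth_lift (ε : ℝ) {U : Set M} (hU : IsOpen U) :
    SmoothHomOn I E (E × (E →L[ℝ] ℝ)) (V₁ := fun x : M => TangentSpace I x)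
      (V₂ := fun x : M => GenTangent I x) (fun x => lift g x ε) U :=
  SmoothHomOn.prod (V₁ := fun x : M => TangentSpace I x) (V₂ := fun x : M => Cotangent I x)
    hU (smoothHomOn_id hU) ((smooth_flat g U).const_smul ε)

theorem smooth_halfProj (ε : ℝ) {U : Set M} (hU : IsOpen U) :
    SmoothHomOn I (E × (E →L[ℝ] ℝ)) E (V₁ := fun x : M => GenTangent I x)
      (V₂ := fun x : M => TangentSpace I x) (fun x => halfProj g x ε) U := by
  have h₁ := smoothHomOn_fst (I := I) (F₁ := E) (F₂ := E →L[ℝ] ℝ)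
    (V₁ := fun x : M => TangentSpace I x) (V₂ := fun x : M => Cotangent I x) hU
  have h₂ := smoothHomOn_snd (I := I) (F₁ := E) (F₂ := E →L[ℝ] ℝ)
    (V₁ := fun x : M => TangentSpace I x) (V₂ := fun x : M => Cotangent I x) hU
  exact (h₁.add (((smooth_sharp g hU).comp hU h₂).const_smul ε)).const_smul (1 / 2)

variable {g}

theorem SmoothEndOn.part {u : Π x, GenTangent I x →L[ℝ] GenTangent I x} {U : Set M}
    (hU : IsOpen U) (hu : SmoothEndOn I (E × (E →L[ℝ] ℝ)) u U) (ε : ℝ) :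
    SmoothEndOn I E (fun x => part g x ε (u x)) U := by
  have h₁ := smoothHomOn_fst (I := I) (F₁ := E) (F₂ := E →L[ℝ] ℝ)
    (V₁ := fun x : M => TangentSpace I x) (V₂ := fun x : M => Cotangent I x) hU
  have hu' : SmoothHomOn I (E × (E →L[ℝ] ℝ)) (E × (E →L[ℝ] ℝ)) u U := hu
  exact SmoothHomOn.comp hU h₁ (hu'.comp hU (smooth_lift g ε hU))

theorem SmoothEndOn.block {a b : Π x : M, TangentSpace I x →L[ℝ] TangentSpace I x} {U : Set M}
    (hU : IsOpen U) (ha : SmoothEndOn I E a U) (hb : SmoothEndOn I E b U) :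
    SmoothEndOn I (E × (E →L[ℝ] ℝ)) (fun x => block g x (a x) (b x)) U := by
  have ha' : SmoothHomOn I E E a U := ha
  have hb' : SmoothHomOn I E E b U := hb
  exact ((smooth_lift g 1 hU).comp hU (hb'.comp hU (smooth_halfProj g 1 hU))).add
    ((smooth_lift g (-1) hU).comp hU (ha'.comp hU (smooth_halfProj g (-1) hU)))

end SmoothHalves

/-! ### Transfer of smoothness between quaternionic frames -/

section Transfer

variable {E : Type*} [NormedAddCommGroup E] [NormedSpace ℝ E]
  {H : Type*} [TopologicalSpace H] {I : ModelWithCorners ℝ E H}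
  {M : Type*} [TopologicalSpace M] [ChartedSpace H M]
  {F : Type*} [NormedAddCommGroup F] [NormedSpace ℝ F]
  {V : M → Type*} [TopologicalSpace (TotalSpace F V)]
  [∀ x, AddCommGroup (V x)] [∀ x, Module ℝ (V x)] [∀ x, TopologicalSpace (V x)]
  [∀ x, IsTopologicalAddGroup (V x)] [∀ x, ContinuousSMul ℝ (V x)]
  [FiberBundle F V] [VectorBundle ℝ F V]

theorem SmoothEndOn.mul {u v : Π x, V x →L[ℝ] V x} {U : Set M} (hU : IsOpen U)
    (hu : SmoothEndOn I F u U) (hv : SmoothEndOn I F v U) :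
    SmoothEndOn I F (fun x => u x * v x) U :=
  SmoothHomOn.comp (I := I) (F₁ := F) (F₂ := F) (F₃ := F) hU hu hv

theorem SmoothEndOn.anticomm {u v : Π x, V x →L[ℝ] V x} {U : Set M} (hU : IsOpen U)
    (hu : SmoothEndOn I F u U) (hv : SmoothEndOn I F v U) :
    SmoothEndOn I F (fun x => (-(1 / 2) : ℝ) • (u x * v x + v x * u x)) U :=
  SmoothHomOn.const_smul (F₁ := F) (F₂ := F) _
    (SmoothHomOn.add (F₁ := F) (F₂ := F) (hu.mul hU hv) (hv.mul hU hu))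

/-- If `v` has the same coordinates with respect to the smooth frame `i', j', i' * j'` as the
smooth field `u` with respect to `i, j, i * j`, then `v` is smooth. -/
theorem SmoothEndOn.of_imComb {u v i j i' j' : Π x, V x →L[ℝ] V x} {U : Set M} (hU : IsOpen U)
    (hu : SmoothEndOn I F u U) (hi : SmoothEndOn I F i U) (hj : SmoothEndOn I F j U)
    (hi' : SmoothEndOn I F i' U) (hj' : SmoothEndOn I F j' U)
    (hq : ∀ x ∈ U, IsQuatPair (i x) (j x))
    (huv : ∀ x ∈ U, ∃ a b c, u x = imComb (i x) (j x) a b c ∧ v x = imComb (i' x) (j' x) a b c) :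
    SmoothEndOn I F v U := by
  -- The anticommutator is the smooth field `a • 1`; multiplying it by `i'` yields the first term of
  -- `v`.
  have h₁ := (hu.anticomm hU hi).mul hU hi'
  have h₂ := (hu.anticomm hU hj).mul hU hj'
  have h₃ := (hu.anticomm hU (hi.mul hU hj)).mul hU (hi'.mul hU hj')
  refine SmoothHomOn.congr (F₁ := F) (F₂ := F)
    (SmoothHomOn.add (F₁ := F) (F₂ := F) (SmoothHomOn.add (F₁ := F) (F₂ := F) h₁ h₂) h₃) ?_
  intro x hx
  obtain ⟨a, b, c, hux, hvx⟩ := huv x hx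
  have h := hq x hx
  rw [hux, h.anticomm_left, h.anticomm_right, h.anticomm_mul, hvx]
  simp only [imComb, smul_mul_assoc, one_mul]

end Transfer
-- From a generalized structure to the triple `(D⁻, D⁺, f)`
section InducedPair

set_option synthInstance.maxHeartbeats 200000

variable {E : Type*} [NormedAddCommGroup E] [NormedSpace ℝ E]
  {H : Type*} [TopologicalSpace H] {I : ModelWithCorners ℝ E H}
  {M : Type*} [TopologicalSpace M] [ChartedSpace H M]
  [FiniteDimensional ℝ E] [IsManifold I ∞ M]
  {g : ContMDiffRiemannianMetric I ∞ E (fun x : M => TangentSpace I x)}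
  {D : Π x : M, Submodule ℝ (GenTangent I x →L[ℝ] GenTangent I x)}

theorem part_imComb {x : M} {i j : GenTangent I x →L[ℝ] GenTangent I x}
    (hj : PreservesHalves g x j) {ε : ℝ} (hε : ε = 1 ∨ ε = -1) (a b c : ℝ) :
    part g x ε (imComb i j a b c) = imComb (part g x ε i) (part g x ε j) a b c := by
  simp only [imComb, map_add, map_smul, part_mul hj hε]

theorem IsQuatPair.part {x : M} {i j : GenTangent I x →L[ℝ] GenTangent I x}
    (h : IsQuatPair i j) (hi : PreservesHalves g x i) (hj : PreservesHalves g x j)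
    {ε : ℝ} (hε : ε = 1 ∨ ε = -1) : IsQuatPair (part g x ε i) (part g x ε j) where
  sq_i := by rw [← part_mul hi hε, h.sq_i, map_neg, part_one]
  sq_j := by rw [← part_mul hj hε, h.sq_j, map_neg, part_one]
  anti := by rw [← part_mul hi hε, ← part_mul hj hε, h.anti, map_neg]

theorem IsGenAQH.exists_frame (hD : IsGenAQH g D) (x₀ : M) :
    ∃ U : Set M, IsOpen U ∧ x₀ ∈ U ∧ ∃ i j : Π x, GenTangent I x →L[ℝ] GenTangent I x,
      SmoothEndOn I (E × (E →L[ℝ] ℝ)) i U ∧ SmoothEndOn I (E × (E →L[ℝ] ℝ)) j U ∧ ∀ y ∈ U,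
        PreservesHalves g y (i y) ∧ PreservesHalves g y (j y) ∧ IsQuatPair (i y) (j y) ∧
        (∀ A B : GenTangent I y, genMetric g y (i y A) (i y B) = genMetric g y A B) ∧
        (∀ A B : GenTangent I y, genMetric g y (j y A) (j y B) = genMetric g y A B) ∧
        D y = Submodule.span ℝ {i y, j y, i y * j y} := by
  obtain ⟨U, hU, hx, i, j, hi, hj, h⟩ := hD x₀
  refine ⟨U, hU, hx, i, j, hi, hj, fun y hy => ?_⟩
  obtain ⟨hPi, hPj, hii, hjj, hij, hspan, -⟩ := h y hy
  exact ⟨preservesHalves_of_isometry hPi.1 hPi.2 hii, preservesHalves_of_isometry hPj.1 hPj.2 hjj,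
    ⟨hii, hjj, hij⟩, hPi.2, hPj.2, hspan⟩

theorem IsGenAQH.finrank_eq_three (hD : IsGenAQH g D) (x : M) : Module.finrank ℝ (D x) = 3 := by
  obtain ⟨U, -, hx, i, j, -, -, h⟩ := hD x
  exact (h x hx).2.2.2.2.2.2

/-- A general `u` in `D` is not an isometry; the property passes from the frame through products and
linear combinations. -/
theorem IsGenAQH.preservesHalves (hD : IsGenAQH g D) {x : M}
    {u : GenTangent I x →L[ℝ] GenTangent I x} (hu : u ∈ D x) : PreservesHalves g x u := by
  obtain ⟨U, -, hx, i, j, -, -, h⟩ := hD.exists_frame x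
  obtain ⟨hi, hj, -, -, -, hspan⟩ := h x hx
  obtain ⟨a, b, c, rfl⟩ := (mem_iff_imComb hspan).1 hu
  exact ((hi.smul a).add (hj.smul b)).add ((hi.mul hj).smul c)

/-- If `TM` vanished at `x`, so would `TM ⊕ T*M`, leaving no room for rank three. Linear
independence of quaternionic frames depends on this nontriviality. -/
theorem IsGenAQH.nontrivial_end (hD : IsGenAQH g D) (x : M) :
    Nontrivial (TangentSpace I x →L[ℝ] TangentSpace I x) := by
  by_contra hT
  rw [not_nontrivial_iff_subsingleton] at hT
  have hA : ∀ A : GenTangent I x, A = 0 := by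
    have hX : ∀ X : TangentSpace I x, X = 0 := fun X =>
      DFunLike.congr_fun (Subsingleton.elim (1 : TangentSpace I x →L[ℝ] TangentSpace I x) 0) X
    intro A
    rw [← lift_halfProj_add g x A, hX (halfProj g x 1 A), hX (halfProj g x (-1) A)]
    simp only [map_zero, add_zero]
  have : Subsingleton (GenTangent I x →L[ℝ] GenTangent I x) :=
    ⟨fun u v => ContinuousLinearMap.ext fun A => (hA (u A)).trans (hA (v A)).symm⟩
  have h := hD.finrank_eq_three x
  rw [Module.finrank_zero_of_subsingleton] at h
  omega

/-- The parts of the frame form a quaternionic pair, hence are linearly independent with their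
product, and `u^ε` has the coordinates of `u`. -/
theorem IsGenAQH.eq_zero_of_part_eq_zero (hD : IsGenAQH g D) {x : M}
    {u : GenTangent I x →L[ℝ] GenTangent I x} (hu : u ∈ D x) {ε : ℝ} (hε : ε = 1 ∨ ε = -1)
    (h0 : part g x ε u = 0) : u = 0 := by
  have := hD.nontrivial_end x
  obtain ⟨U, -, hx, i, j, -, -, h⟩ := hD.exists_frame x
  obtain ⟨hi, hj, hq, -, -, hspan⟩ := h x hx
  obtain ⟨a, b, c, rfl⟩ := (mem_iff_imComb hspan).1 hu
  rw [part_imComb hj hε] at h0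
  obtain ⟨rfl, rfl, rfl⟩ := (hq.part hi hj hε).imComb_eq_zero h0
  simp only [imComb, zero_smul, add_zero]

theorem IsGenAQH.part_injOn (hD : IsGenAQH g D) {x : M}
    {u v : GenTangent I x →L[ℝ] GenTangent I x} (hu : u ∈ D x) (hv : v ∈ D x) {ε : ℝ}
    (hε : ε = 1 ∨ ε = -1) (h : part g x ε u = part g x ε v) : u = v :=
  sub_eq_zero.1 <| hD.eq_zero_of_part_eq_zero (end_sub_mem hu hv) hε
    (((part g x ε).map_sub u v).trans (sub_eq_zero.2 h))

/-- The isomorphism `D → D^ε`, `u ↦ u^ε`. -/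
def partEquiv (hD : IsGenAQH g D) (x : M) {ε : ℝ} (hε : ε = 1 ∨ ε = -1) :
    D x ≃ₗ[ℝ] (D x).map (part g x ε) :=
  LinearEquiv.ofBijective ((part g x ε).submoduleMap (D x))
    ⟨fun u v h => Subtype.ext (hD.part_injOn u.2 v.2 hε (congrArg Subtype.val h)),
      (part g x ε).submoduleMap_surjective (D x)⟩

theorem map_part_span {x : M} {i j : GenTangent I x →L[ℝ] GenTangent I x}
    (hj : PreservesHalves g x j) {ε : ℝ} (hε : ε = 1 ∨ ε = -1) :
    (Submodule.span ℝ {i, j, i * j}).map (part g x ε) =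
      Submodule.span ℝ {part g x ε i, part g x ε j, part g x ε i * part g x ε j} := by
  rw [Submodule.map_span, Set.image_insert_eq, Set.image_insert_eq, Set.image_singleton,
    part_mul hj hε]

theorem IsGenAQH.isAQH_map_part (hD : IsGenAQH g D) {ε : ℝ} (hε : ε = 1 ∨ ε = -1) :
    IsAQH g (fun x => (D x).map (part g x ε)) := by
  intro x₀
  obtain ⟨U, hU, hx, i, j, hi, hj, h⟩ := hD.exists_frame x₀
  refine ⟨U, hU, hx, fun x => part g x ε (i x), fun x => part g x ε (j x), hi.part hU ε,
    hj.part hU ε, fun y hy => ?_⟩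
  obtain ⟨hPi, hPj, hq, hmi, hmj, hspan⟩ := h y hy
  have hq' := hq.part hPi hPj hε
  refine ⟨fun X Y => hPi.inner_part hε X Y hmi, fun X Y => hPj.inner_part hε X Y hmj,
    hq'.sq_i, hq'.sq_j, hq'.anti, ?_, ?_⟩
  · exact (congrArg (Submodule.map (part g y ε)) hspan).trans (map_part_span hPj hε)
  · rw [← (partEquiv hD y hε).finrank_eq, hD.finrank_eq_three]

/-- A section of `D` is smooth as soon as the section of `D^ε` that it induces is. -/
theorem IsGenAQH.smooth_of_part (hD : IsGenAQH g D) {U : Set M} (hU : IsOpen U)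
    {v : Π x, GenTangent I x →L[ℝ] GenTangent I x} (hv : ∀ x ∈ U, v x ∈ D x)
    {ε : ℝ} (hε : ε = 1 ∨ ε = -1) (h : SmoothEndOn I E (fun x => part g x ε (v x)) U) :
    SmoothEndOn I (E × (E →L[ℝ] ℝ)) v U := by
  refine SmoothHomOn.of_locally fun x₀ hx₀ => ?_
  obtain ⟨U', hU', hx, i, j, hi, hj, hf⟩ := hD.exists_frame x₀
  refine ⟨U', hU', hx, ?_⟩
  have hUU := hU.inter hU'
  -- Both parts of `v` have the same coordinates in their frames, so smoothness of one half passes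
  -- to the other; `v` is then the block of two smooth fields.
  have hs : ∀ ε' : ℝ, ε' = 1 ∨ ε' = -1 → SmoothEndOn I E (fun x => part g x ε' (v x)) (U ∩ U') := by
    intro ε' hε'
    have hi' : SmoothEndOn I (E × (E →L[ℝ] ℝ)) i (U ∩ U') := hi.mono Set.inter_subset_right
    have hj' : SmoothEndOn I (E × (E →L[ℝ] ℝ)) j (U ∩ U') := hj.mono Set.inter_subset_right
    refine SmoothEndOn.of_imComb hUU (h.mono Set.inter_subset_left) (hi'.part (g := g) hUU ε)
      (hj'.part (g := g) hUU ε) (hi'.part (g := g) hUU ε') (hj'.part (g := g) hUU ε')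
      (fun x hx => ?_) fun x hx => ?_
    · obtain ⟨hPi, hPj, hq, -⟩ := hf x hx.2
      exact hq.part hPi hPj hε
    · obtain ⟨hPi, hPj, hq, -, -, hspan⟩ := hf x hx.2
      obtain ⟨a, b, c, habc⟩ := (mem_iff_imComb hspan).1 (hv x hx.1)
      refine ⟨a, b, c, ?_, ?_⟩
      · rw [← habc, part_imComb hPj hε]
      · rw [← habc, part_imComb hPj hε']
  refine SmoothHomOn.congr (F₁ := E × (E →L[ℝ] ℝ)) (F₂ := E × (E →L[ℝ] ℝ))
    ((hs (-1) (.inr rfl)).block (g := g) hUU (hs 1 (.inl rfl))) fun x hx => ?_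
  refine (hD.preservesHalves (hv x hx.1)).ext (preservesHalves_block _ _ _) ?_ ?_
  · rw [part_neg_one_block]
  · rw [part_one_block]

/-- A pointwise choice of preimages in `D` is enough: `smooth_of_part` makes it smooth. -/
theorem IsGenAQH.exists_section (hD : IsGenAQH g D) {U : Set M} (hU : IsOpen U)
    {u : Π x : M, TangentSpace I x →L[ℝ] TangentSpace I x} (hu : SmoothEndOn I E u U) {ε : ℝ}
    (hε : ε = 1 ∨ ε = -1) (huD : ∀ x ∈ U, u x ∈ (D x).map (part g x ε)) :
    ∃ v : Π x, GenTangent I x →L[ℝ] GenTangent I x, SmoothEndOn I (E × (E →L[ℝ] ℝ)) v U ∧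
      ∀ x ∈ U, v x ∈ D x ∧ part g x ε (v x) = u x := by
  have : ∀ x, ∃ w, x ∈ U → w ∈ D x ∧ part g x ε w = u x := by
    intro x
    by_cases hx : x ∈ U
    · obtain ⟨w, hw, h⟩ := huD x hx
      exact ⟨w, fun _ => ⟨hw, h⟩⟩
    · exact ⟨0, fun h => absurd h hx⟩
  choose v hv using this
  refine ⟨v, hD.smooth_of_part hU (fun x hx => (hv x hx).1) hε ?_, hv⟩
  exact SmoothHomOn.congr (F₁ := E) (F₂ := E) hu fun x hx => (hv x hx).2

theorem applyIso_of_mem {D D' : Π x : M, Submodule ℝ (TangentSpace I x →L[ℝ] TangentSpace I x)}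
    (f : Π x, D x ≃ₗ[ℝ] D' x) {u : Π x : M, TangentSpace I x →L[ℝ] TangentSpace I x} {x : M}
    (h : u x ∈ D x) : applyIso f u x = f x ⟨u x, h⟩ :=
  dif_pos h

theorem partEquiv_symm_part (hD : IsGenAQH g D) {x : M} {ε : ℝ} (hε : ε = 1 ∨ ε = -1)
    {u : GenTangent I x →L[ℝ] GenTangent I x} (hu : u ∈ D x)
    (h : part g x ε u ∈ (D x).map (part g x ε)) :
    (partEquiv hD x hε).symm ⟨part g x ε u, h⟩ = ⟨u, hu⟩ := by
  rw [LinearEquiv.symm_apply_eq]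
  rfl

theorem coe_partEquiv_trans (hD : IsGenAQH g D) {x : M}
    {u : GenTangent I x →L[ℝ] GenTangent I x} (hu : u ∈ D x)
    (h : part g x (-1) u ∈ (D x).map (part g x (-1))) :
    ((((partEquiv hD x (ε := -1) (.inr rfl)).symm.trans (partEquiv hD x (ε := 1) (.inl rfl)))
      ⟨part g x (-1) u, h⟩ : (D x).map (part g x 1)) : TangentSpace I x →L[ℝ] TangentSpace I x) =
      part g x 1 u := by
  rw [LinearEquiv.trans_apply, partEquiv_symm_part hD _ hu]
  rfl

/-- The triple `(D⁻, D⁺, f)` induced by a generalized almost quaternionic Hermitian structure. -/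
def inducedPair (hD : IsGenAQH g D) : QuatPair g where
  Dm x := (D x).map (part g x (-1))
  Dp x := (D x).map (part g x 1)
  isAQH_Dm := hD.isAQH_map_part (.inr rfl)
  isAQH_Dp := hD.isAQH_map_part (.inl rfl)
  f x := (partEquiv hD x (ε := -1) (.inr rfl)).symm.trans (partEquiv hD x (ε := 1) (.inl rfl))
  smooth U u hU hu huD := by
    -- With `v` a smooth section of `D` such that `v⁻ = u`, the field `f(u)` is `v⁺`.
    obtain ⟨v, hv, hvD⟩ := hD.exists_section hU hu (.inr rfl) huD
    refine SmoothHomOn.congr (F₁ := E) (F₂ := E) (hv.part (g := g) hU 1) fun x hx => ?_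
    rw [applyIso_of_mem _ (huD x hx), ← coe_partEquiv_trans hD (hvD x hx).1
      (Submodule.mem_map_of_mem (hvD x hx).1)]
    congr 3
    exact (hvD x hx).2.symm
  isAlg x := by
    have := hD.nontrivial_end x
    obtain ⟨U, -, hx, i, j, -, -, h⟩ := hD.exists_frame x
    obtain ⟨hi, hj, hq, -, -, hspan⟩ := h x hx
    have hm := (congrArg (Submodule.map (part g x (-1))) hspan).trans
      (map_part_span hj (.inr rfl))
    have hp := (congrArg (Submodule.map (part g x 1)) hspan).trans (map_part_span hj (.inl rfl))
    obtain ⟨φ, hφ⟩ := (hq.part hi hj (.inr rfl)).exists_algEquiv (hq.part hi hj (.inl rfl)) hm hp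
    refine ⟨φ, ?_⟩
    rintro u ⟨w, hw, rfl⟩
    obtain ⟨a, b, c, rfl⟩ := (mem_iff_imComb hspan).1 hw
    have hmem : imComb (part g x (-1) (i x)) (part g x (-1) (j x)) a b c ∈
        (D x).map (part g x (-1)) :=
      ⟨_, hw, part_imComb hj (.inr rfl) a b c⟩
    refine Eq.trans ?_ (coe_partEquiv_trans hD hw _).symm
    refine Eq.trans ?_ (part_imComb hj (.inl rfl) a b c).symm
    refine Eq.trans ?_ (hφ a b c (Algebra.subset_adjoin hmem))
    exact congrArg (fun z => (φ z : TangentSpace I x →L[ℝ] TangentSpace I x))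
      (Subtype.ext (part_imComb hj (.inr rfl) a b c))

theorem isInducedBy_inducedPair (hD : IsGenAQH g D) : (inducedPair hD).IsInducedBy D := by
  refine fun x => ⟨rfl, rfl, fun u hu => ⟨hD.preservesHalves hu 1 (.inl rfl),
    hD.preservesHalves hu (-1) (.inr rfl), Submodule.mem_map_of_mem hu, ?_⟩⟩
  exact coe_partEquiv_trans hD hu _

namespace QuatPair.IsInducedBy

variable {p q : QuatPair g} {D' : Π x : M, Submodule ℝ (GenTangent I x →L[ℝ] GenTangent I x)}

theorem preservesHalves (h : p.IsInducedBy D) {x : M} {u : GenTangent I x →L[ℝ] GenTangent I x}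
    (hu : u ∈ D x) : PreservesHalves g x u := by
  obtain ⟨hp, hm, -⟩ := (h x).2.2 u hu
  rintro ε (rfl | rfl)
  exacts [hp, hm]

theorem part_mem (h : p.IsInducedBy D) {x : M} {u : GenTangent I x →L[ℝ] GenTangent I x}
    (hu : u ∈ D x) : part g x (-1) u ∈ p.Dm x :=
  ((h x).2.2 u hu).2.2.1

theorem f_part (h : p.IsInducedBy D) {x : M} {u : GenTangent I x →L[ℝ] GenTangent I x}
    (hu : u ∈ D x) : (p.f x ⟨part g x (-1) u, h.part_mem hu⟩ :
      TangentSpace I x →L[ℝ] TangentSpace I x) = part g x 1 u :=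
  ((h x).2.2 u hu).2.2.2

/-- The triple determines `D`: an element `w` of `D` with `w⁻ = u⁻` also has `w⁺ = f(w⁻) = u⁺`, and
the two parts determine an endomorphism preserving both halves. -/
theorem mem_iff (h : p.IsInducedBy D) {x : M} {u : GenTangent I x →L[ℝ] GenTangent I x} :
    u ∈ D x ↔ PreservesHalves g x u ∧ ∃ hu : part g x (-1) u ∈ p.Dm x,
      (p.f x ⟨part g x (-1) u, hu⟩ : TangentSpace I x →L[ℝ] TangentSpace I x) = part g x 1 u := by
  refine ⟨fun hu => ⟨h.preservesHalves hu, h.part_mem hu, h.f_part hu⟩, ?_⟩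
  rintro ⟨hu, hm, hf⟩
  have hm' := hm
  rw [(h x).2.1] at hm'
  obtain ⟨w, hw, hwu⟩ := hm'
  have : w = u := by
    refine (h.preservesHalves hw).ext hu hwu ?_
    rw [← hf, ← h.f_part hw]
    congr 3
  rwa [← this]

theorem eq_left (h : p.IsInducedBy D) (h' : p.IsInducedBy D') : D = D' := by
  funext x
  ext u
  rw [h.mem_iff, h'.mem_iff]

/-- Every element of `D⁻` is some `w⁻` with `w` in `D`, which forces `f(w⁻) = w⁺`; the remaining
fields are propositions. -/
theorem eq_right (h : p.IsInducedBy D) (h' : q.IsInducedBy D) : p = q := by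
  have hm : p.Dm = q.Dm := funext fun x => (h x).2.1.trans (h' x).2.1.symm
  have hp : p.Dp = q.Dp := funext fun x => (h x).1.trans (h' x).1.symm
  obtain ⟨Dm, Dp, _, _, f, _, _⟩ := p
  obtain ⟨Dm', Dp', _, _, f', _, _⟩ := q
  obtain rfl : Dm = Dm' := hm
  obtain rfl : Dp = Dp' := hp
  have : f = f' := by
    funext x
    refine LinearEquiv.ext fun ⟨u, hu⟩ => Subtype.ext ?_
    have hmap : Dm x = (D x).map (part g x (-1)) := (h x).2.1
    obtain ⟨w, hw, rfl⟩ := hmap ▸ hu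
    exact (h.f_part hw).trans (h'.f_part hw).symm
  subst this
  rfl

end QuatPair.IsInducedBy

end InducedPair
-- From a triple back to a generalized structure
section Reconstruction

set_option synthInstance.maxHeartbeats 200000

variable {E : Type*} [NormedAddCommGroup E] [NormedSpace ℝ E]
  {H : Type*} [TopologicalSpace H] {I : ModelWithCorners ℝ E H}
  {M : Type*} [TopologicalSpace M] [ChartedSpace H M]
  [FiniteDimensional ℝ E] [IsManifold I ∞ M]
  {g : ContMDiffRiemannianMetric I ∞ E (fun x : M => TangentSpace I x)}

theorem isometry_skew {x : M} {u : TangentSpace I x →L[ℝ] TangentSpace I x}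
    (hu : ∀ X Y, g.inner x (u X) (u Y) = g.inner x X Y) (hsq : u * u = -1)
    (X Y : TangentSpace I x) : g.inner x (u X) Y = -g.inner x X (u Y) := by
  have h : u (u X) = -X := DFunLike.congr_fun hsq X
  rw [← hu (u X) Y, h, map_neg, neg_apply]

/-- Unlike orthogonality, skewness is linear in `u`, so it spreads from the frame to all of `D`; the
product of two anticommuting skew maps is skew. -/
theorem IsAQH.skew {D : Π x : M, Submodule ℝ (TangentSpace I x →L[ℝ] TangentSpace I x)}
    (hD : IsAQH g D) {x : M} {u : TangentSpace I x →L[ℝ] TangentSpace I x} (hu : u ∈ D x)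
    (X Y : TangentSpace I x) : g.inner x (u X) Y = -g.inner x X (u Y) := by
  obtain ⟨U, -, hx, i, j, -, -, h⟩ := hD x
  obtain ⟨hi, hj, hii, hjj, hij, hspan, -⟩ := h x hx
  obtain ⟨a, b, c, rfl⟩ := (mem_iff_imComb hspan).1 hu
  have si := isometry_skew hi hii
  have sj := isometry_skew hj hjj
  have hk : ∀ Z, i x (j x Z) = -j x (i x Z) := fun Z => DFunLike.congr_fun hij Z
  have e : ∀ Z, imComb (i x) (j x) a b c Z = a • i x Z + b • j x Z + c • i x (j x Z) :=
    fun _ => rfl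
  have sk : g.inner x (i x (j x X)) Y = -g.inner x X (i x (j x Y)) := by
    rw [si, sj, neg_neg, hk Y, map_neg, neg_neg]
  simp only [e, map_add, map_smul, add_apply, smul_apply, smul_eq_mul, si X Y, sj X Y, sk]
  ring

/-- Needed for `f(i)` and `f(j)`, which lie in `D⁺` but need not belong to its given frame. -/
theorem IsAQH.isometry {D : Π x : M, Submodule ℝ (TangentSpace I x →L[ℝ] TangentSpace I x)}
    (hD : IsAQH g D) {x : M} {u : TangentSpace I x →L[ℝ] TangentSpace I x} (hu : u ∈ D x)
    (hsq : u * u = -1) (X Y : TangentSpace I x) :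
    g.inner x (u X) (u Y) = g.inner x X Y := by
  have h : u (u Y) = -Y := DFunLike.congr_fun hsq Y
  rw [hD.skew hu, h, map_neg, neg_neg]

namespace QuatPair

variable (p : QuatPair g)

/-- Landing in the full endomorphism algebra lets algebraic identities pass through `f` without
tracking membership in the generated subalgebra of `D⁺`. -/
theorem exists_algHom (x : M) :
    ∃ ψ : Algebra.adjoin ℝ (p.Dm x : Set (TangentSpace I x →L[ℝ] TangentSpace I x)) →ₐ[ℝ]
      (TangentSpace I x →L[ℝ] TangentSpace I x),
    ∀ (u : TangentSpace I x →L[ℝ] TangentSpace I x) (hu : u ∈ p.Dm x),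
      ψ ⟨u, Algebra.subset_adjoin hu⟩ = p.f x ⟨u, hu⟩ := by
  obtain ⟨φ, hφ⟩ := p.isAlg x
  exact ⟨(Subalgebra.val _).comp φ.toAlgHom, hφ⟩

variable {p} {x : M} {u v : TangentSpace I x →L[ℝ] TangentSpace I x}

theorem f_mul (hu : u ∈ p.Dm x) (hv : v ∈ p.Dm x) (huv : u * v ∈ p.Dm x) :
    (p.f x ⟨u * v, huv⟩ : TangentSpace I x →L[ℝ] TangentSpace I x) =
      p.f x ⟨u, hu⟩ * p.f x ⟨v, hv⟩ := by
  obtain ⟨ψ, hψ⟩ := p.exists_algHom x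
  rw [← hψ, ← hψ, ← hψ, ← map_mul]
  rfl

theorem f_isQuatPair (hu : u ∈ p.Dm x) (hv : v ∈ p.Dm x) (h : IsQuatPair u v) :
    IsQuatPair (p.f x ⟨u, hu⟩ : TangentSpace I x →L[ℝ] TangentSpace I x)
      (p.f x ⟨v, hv⟩ : TangentSpace I x →L[ℝ] TangentSpace I x) := by
  obtain ⟨ψ, hψ⟩ := p.exists_algHom x
  rw [← hψ, ← hψ]
  refine ⟨?_, ?_, ?_⟩
  · rw [← map_mul, ← map_one ψ, ← map_neg]
    exact congrArg ψ (Subtype.ext h.sq_i)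
  · rw [← map_mul, ← map_one ψ, ← map_neg]
    exact congrArg ψ (Subtype.ext h.sq_j)
  · rw [← map_mul, ← map_mul, ← map_neg]
    exact congrArg ψ (Subtype.ext h.anti)

variable (p) in
/-- The linear map `u ↦ (u, f(u))` from `D⁻` to the endomorphisms of `TM ⊕ T*M`. -/
def blockMap (x : M) : p.Dm x →ₗ[ℝ] (GenTangent I x →L[ℝ] GenTangent I x) where
  toFun u := block g x u (p.f x u)
  map_add' u v := by
    refine ContinuousLinearMap.ext fun A => ?_
    simp only [map_add, Submodule.coe_add, add_apply, block_apply]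
    abel
  map_smul' r u := by
    refine ContinuousLinearMap.ext fun A => ?_
    simp only [map_smul, Submodule.coe_smul, smul_apply, block_apply, RingHom.id_apply, smul_add]

variable (p) in
/-- The bundle of endomorphisms of `TM ⊕ T*M` associated with a triple `(D⁻, D⁺, f)`. -/
def genBundle (x : M) : Submodule ℝ (GenTangent I x →L[ℝ] GenTangent I x) :=
  LinearMap.range (p.blockMap x)

theorem blockMap_injective : Function.Injective (p.blockMap x) := fun u v h => by
  have h' := congrArg (part g x (-1)) h
  change part g x (-1) (block g x _ _) = part g x (-1) (block g x _ _) at h'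
  rw [part_neg_one_block, part_neg_one_block] at h'
  exact Subtype.ext h'

theorem isInducedBy_genBundle : p.IsInducedBy p.genBundle := by
  intro x
  refine ⟨?_, ?_, ?_⟩
  · ext b
    constructor
    · intro hb
      refine ⟨_, ⟨(p.f x).symm ⟨b, hb⟩, rfl⟩, (part_one_block x _ _).trans ?_⟩
      rw [LinearEquiv.apply_symm_apply]
    · rintro ⟨_, ⟨u, rfl⟩, rfl⟩
      exact (part_one_block x (u : TangentSpace I x →L[ℝ] TangentSpace I x) (p.f x u)).symm ▸
        (p.f x u).2
  · ext a
    constructor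
    · intro ha
      exact ⟨_, ⟨⟨a, ha⟩, rfl⟩, part_neg_one_block x _ _⟩
    · rintro ⟨_, ⟨u, rfl⟩, rfl⟩
      exact (part_neg_one_block x (u : TangentSpace I x →L[ℝ] TangentSpace I x) (p.f x u)).symm ▸
        u.2
  · rintro _ ⟨u, rfl⟩
    have hm : part g x (-1) (p.blockMap x u) = u := part_neg_one_block x _ _
    have hp : part g x 1 (p.blockMap x u) = p.f x u := part_one_block x _ _
    refine ⟨preservesHalves_block _ _ _ 1 (.inl rfl), preservesHalves_block _ _ _ (-1) (.inr rfl),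
      hm ▸ u.2, ?_⟩
    rw [hp]
    exact congrArg (fun z => (p.f x z : TangentSpace I x →L[ℝ] TangentSpace I x)) (Subtype.ext hm)

theorem blockMap_eq (u : p.Dm x) : p.blockMap x u = block g x u (p.f x u) := rfl

-- A frame `i, j` of `D⁻` yields the blocks `(i, f(i))` and `(j, f(j))`, whose product is `(i * j,
-- f(i * j))` since `f` is multiplicative.
variable (p) in
theorem isGenAQH_genBundle : IsGenAQH g p.genBundle := by
  intro x₀
  obtain ⟨U, hU, hx, i, j, hi, hj, h⟩ := p.isAQH_Dm x₀
  have mem : ∀ y ∈ U, i y ∈ p.Dm y ∧ j y ∈ p.Dm y ∧ i y * j y ∈ p.Dm y := by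
    intro y hy
    have hspan := (h y hy).2.2.2.2.2.1
    refine ⟨?_, ?_, ?_⟩ <;> rw [hspan] <;> apply Submodule.subset_span <;> simp
  have smooth : ∀ u : Π x : M, TangentSpace I x →L[ℝ] TangentSpace I x, SmoothEndOn I E u U →
      (∀ y ∈ U, u y ∈ p.Dm y) →
      SmoothEndOn I (E × (E →L[ℝ] ℝ)) (fun y => block g y (u y) (applyIso p.f u y)) U :=
    fun u hu huD => hu.block hU (p.smooth U u hU hu huD)
  refine ⟨U, hU, hx, _, _, smooth i hi fun y hy => (mem y hy).1,
    smooth j hj fun y hy => (mem y hy).2.1, fun y hy => ?_⟩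
  obtain ⟨hPi, hPj, hii, hjj, hij, hspan, hrank⟩ := h y hy
  obtain ⟨hiD, hjD, hijD⟩ := mem y hy
  have hq := f_isQuatPair hiD hjD ⟨hii, hjj, hij⟩
  simp only [applyIso_of_mem _ hiD, applyIso_of_mem _ hjD, block_mul]
  refine ⟨block_isometry hPi (p.isAQH_Dp.isometry (p.f y _).2 hq.sq_i),
    block_isometry hPj (p.isAQH_Dp.isometry (p.f y _).2 hq.sq_j), ?_, ?_, ?_, ?_, ?_⟩
  · rw [hii, hq.sq_i, block_neg, block_one]
  · rw [hjj, hq.sq_j, block_neg, block_one]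
  · rw [hij, hq.anti, block_neg]
  -- The spanning statement is moved inside the subspace `D⁻`, where `blockMap` is defined, so that
  -- it can be pushed to the range.
  · have htop : (⊤ : Submodule ℝ (p.Dm y)) =
        Submodule.span ℝ {⟨i y, hiD⟩, ⟨j y, hjD⟩, ⟨i y * j y, hijD⟩} := by
      refine Submodule.map_injective_of_injective (p.Dm y).injective_subtype ?_
      rw [Submodule.map_span, Submodule.map_top, Submodule.range_subtype, Set.image_insert_eq,
        Set.image_insert_eq, Set.image_singleton]
      exact hspan
    rw [genBundle, LinearMap.range_eq_map, htop, Submodule.map_span, Set.image_insert_eq,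
      Set.image_insert_eq, Set.image_singleton, blockMap_eq, blockMap_eq, blockMap_eq,
      f_mul hiD hjD]
  · exact (LinearMap.finrank_range_of_inj blockMap_injective).trans hrank

variable (g) in
/-- The bijection `D ↦ (D⁻, D⁺, f)`. -/
def inducedEquiv :
    {D : Π x : M, Submodule ℝ (GenTangent I x →L[ℝ] GenTangent I x) // IsGenAQH g D} ≃
      QuatPair g :=
  Equiv.ofBijective (fun D => inducedPair D.2)
    ⟨fun D D' h => Subtype.ext <| (isInducedBy_inducedPair D.2).eq_left <|
        (show inducedPair D.2 = inducedPair D'.2 from h) ▸ isInducedBy_inducedPair D'.2,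
      fun p => ⟨⟨p.genBundle, p.isGenAQH_genBundle⟩,
        (isInducedBy_inducedPair p.isGenAQH_genBundle).eq_right isInducedBy_genBundle⟩⟩

theorem isInducedBy_inducedEquiv
    (D : {D : Π x : M, Submodule ℝ (GenTangent I x →L[ℝ] GenTangent I x) // IsGenAQH g D}) :
    (inducedEquiv g D).IsInducedBy D.1 :=
  isInducedBy_inducedPair D.2

end QuatPair

end Reconstruction
-- Compatibility with the Levi-Civita connection
section Parallel

set_option synthInstance.maxHeartbeats 200000

variable {E : Type*} [NormedAddCommGroup E] [NormedSpace ℝ E]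
  {H : Type*} [TopologicalSpace H] {I : ModelWithCorners ℝ E H}
  {M : Type*} [TopologicalSpace M] [ChartedSpace H M]
  [FiniteDimensional ℝ E] [IsManifold I ∞ M]
  {g : ContMDiffRiemannianMetric I ∞ E (fun x : M => TangentSpace I x)}
  {c : CovariantDerivative I E (fun x : M => TangentSpace I x)}

theorem mdiffAt_lift (ε : ℝ) {s : Π x : M, TangentSpace I x} {x : M}
    (hs : MDiffAt (fun y => TotalSpace.mk' E y (s y)) x) :
    MDiffAt (fun y => TotalSpace.mk' (E × (E →L[ℝ] ℝ)) (E := fun x : M => GenTangent I x) y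
      (lift g y ε (s y))) x := by
  have h : SmoothHomOn I E (E × (E →L[ℝ] ℝ)) (V₁ := fun x : M => TangentSpace I x)
      (V₂ := fun x : M => GenTangent I x) (fun x => lift g x ε) Set.univ :=
    smooth_lift g ε isOpen_univ
  exact mdiff_app (V := fun x : M => TangentSpace I x) (W := fun x : M => GenTangent I x)
    ((h.contMDiffAt Filter.univ_mem).mdifferentiableAt (by simp)) hs

theorem mdiffAt_of_smooth {F : Type*} [NormedAddCommGroup F] [NormedSpace ℝ F]
    {V : M → Type*} [TopologicalSpace (TotalSpace F V)]
    [∀ x, AddCommGroup (V x)] [∀ x, Module ℝ (V x)] [∀ x, TopologicalSpace (V x)]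
    [∀ x, IsTopologicalAddGroup (V x)] [∀ x, ContinuousSMul ℝ (V x)]
    [FiberBundle F V] [VectorBundle ℝ F V] {u : Π x, V x →L[ℝ] V x} {U : Set M} (hU : IsOpen U)
    (hu : SmoothEndOn I F u U) {x : M} (hx : x ∈ U) :
    MDiffAt (fun y => TotalSpace.mk' (F →L[ℝ] F) (E := fun z => V z →L[ℝ] V z) y (u y)) x :=
  (hu.contMDiffAt (hU.mem_nhds hx)).mdifferentiableAt (by simp)

/-- A metric connection commutes with `X ↦ X + ε g(X, ·)`. -/
theorem genCov_lift (hc : IsLeviCivita g c) (ε : ℝ) {s : Π x : M, TangentSpace I x} {x : M}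
    (hs : MDiffAt (fun y => TotalSpace.mk' E y (s y)) x) (X : TangentSpace I x) :
    genCov c (fun y => lift g y ε (s y)) x X = lift g x ε (c s x X) := by
  -- Only the cotangent components need comparison; they are tested on a local extension of `Y`,
  -- where metric compatibility cancels the term in `∇Y`.
  refine Prod.ext rfl (ContinuousLinearMap.ext fun Y => ?_)
  have hY := mdifferentiableAt_extend I E Y
  have h1 := mdiff_snd (V := fun x : M => TangentSpace I x) (W := fun x : M => Cotangent I x)
    (mdiffAt_lift (g := g) ε hs)
  have h2 := homCov_apply c (trivialCov I M) h1 hY X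
  rw [extend_apply_self] at h2
  refine h2.trans ?_
  have h3 := ((isLeviCivita_iff g c).1 hc).1 x s (extend E Y) X hs hY
  rw [extend_apply_self] at h3
  have h4 : mvfderiv I (fun y => ε • g.inner y (s y) (extend E Y y)) x X =
      ε • mvfderiv I (fun y => g.inner y (s y) (extend E Y y)) x X := by
    have hflat : SmoothHomOn I E (E →L[ℝ] ℝ) (V₁ := fun x : M => TangentSpace I x)
      (V₂ := fun x : M => Cotangent I x) (fun x => g.inner x) Set.univ := smooth_flat g _
    have hfs := mdiff_app (V := fun x : M => TangentSpace I x) (W := fun x : M => Cotangent I x)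
      ((hflat.contMDiffAt Filter.univ_mem).mdifferentiableAt (by simp)) hs
    have hfsY := mdiff_trivial (mdiff_app (V := fun x : M => TangentSpace I x)
      (W := Bundle.Trivial M ℝ) hfs hY)
    have h := mvfderiv_fun_smul (a := fun _ : M => ε) mdifferentiableAt_const hfsY
    rw [mvfderiv_const (I := I) ε] at h
    refine (DFunLike.congr_fun h X).trans ?_
    simp
  change mvfderiv I (fun y => ε • g.inner y (s y) (extend E Y y)) x X -
    ε • g.inner x (s x) (c (extend E Y) x X) = ε • g.inner x (c s x X) Y
  rw [h4, h3, smul_add, add_sub_cancel_right]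

/-- Expand `(∇u)(s) = ∇(u s) - u(∇s)` on a lifted section: both `∇` and `u` pass through the lift.
-/
theorem homCov_lift (hc : IsLeviCivita g c) {u : Π x, GenTangent I x →L[ℝ] GenTangent I x}
    {U : Set M} (hU : IsOpen U) (hu : SmoothEndOn I (E × (E →L[ℝ] ℝ)) u U)
    (hP : ∀ x ∈ U, PreservesHalves g x (u x)) {x : M} (hx : x ∈ U) (X : TangentSpace I x)
    {ε : ℝ} (hε : ε = 1 ∨ ε = -1) (Y : TangentSpace I x) :
    homCov (genCov c) (genCov c) u x X (lift g x ε Y) =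
      lift g x ε (homCov c c (fun y => part g y ε (u y)) x X Y) := by
  have hY := mdifferentiableAt_extend I E Y
  have hlY := mdiffAt_lift (g := g) ε hY
  have hud := mdiffAt_of_smooth hU hu hx
  have hpd := mdiffAt_of_smooth hU (hu.part (g := g) hU ε) hx
  have h1 := homCov_apply (genCov c) (genCov c) hud hlY X
  have h2 := homCov_apply c c hpd hY X
  rw [extend_apply_self] at h1 h2
  have hpY := mdiff_app (V := fun x : M => TangentSpace I x) (W := fun x : M => TangentSpace I x)
    hpd hY
  rw [h1, h2, genCov_lift hc ε hY, hP x hx ε hε, map_sub, ← genCov_lift hc ε hpY]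
  congr 2
  -- `u` preserves the halves only on `U`, so the two sections agree merely near `x`; locality of
  -- the connection suffices.
  refine (genCov c).isCovariantDerivativeOnUniv.congr_of_eventuallyEq
    (mdiff_app (V := fun x : M => GenTangent I x) (W := fun x : M => GenTangent I x) hud hlY)
    (mdiffAt_lift ε hpY) Filter.univ_mem ?_
  filter_upwards [hU.mem_nhds hx] with y hy using hP y hy ε hε _

theorem preservesHalves_homCov (hc : IsLeviCivita g c)
    {u : Π x, GenTangent I x →L[ℝ] GenTangent I x}
    {U : Set M} (hU : IsOpen U) (hu : SmoothEndOn I (E × (E →L[ℝ] ℝ)) u U)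
    (hP : ∀ x ∈ U, PreservesHalves g x (u x)) {x : M} (hx : x ∈ U) (X : TangentSpace I x) :
    PreservesHalves g x (homCov (genCov c) (genCov c) u x X) := by
  intro ε hε Y
  rw [part_apply, homCov_lift hc hU hu hP hx X hε]
  rfl

theorem part_homCov (hc : IsLeviCivita g c) {u : Π x, GenTangent I x →L[ℝ] GenTangent I x}
    {U : Set M} (hU : IsOpen U) (hu : SmoothEndOn I (E × (E →L[ℝ] ℝ)) u U)
    (hP : ∀ x ∈ U, PreservesHalves g x (u x)) {x : M} (hx : x ∈ U) (X : TangentSpace I x)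
    {ε : ℝ} (hε : ε = 1 ∨ ε = -1) :
    part g x ε (homCov (genCov c) (genCov c) u x X) =
      homCov c c (fun y => part g y ε (u y)) x X := by
  refine ContinuousLinearMap.ext fun Y => ?_
  rw [part_apply, homCov_lift hc hU hu hP hx X hε]
  rfl

theorem homCov_congr {U : Set M} (hU : IsOpen U)
    {u v : Π x : M, TangentSpace I x →L[ℝ] TangentSpace I x} (hu : SmoothEndOn I E u U)
    (huv : ∀ x ∈ U, u x = v x) {x : M} (hx : x ∈ U) : homCov c c u x = homCov c c v x := by
  have hv : SmoothEndOn I E v U :=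
    SmoothHomOn.congr (F₁ := E) (F₂ := E) hu fun y hy => (huv y hy).symm
  exact (homCov c c).isCovariantDerivativeOnUniv.congr_of_eventuallyEq (mdiffAt_of_smooth hU hu hx)
    (mdiffAt_of_smooth hU hv hx) Filter.univ_mem
    (Filter.mem_of_superset (hU.mem_nhds hx) huv)

variable {D : Π x : M, Submodule ℝ (GenTangent I x →L[ℝ] GenTangent I x)} {p : QuatPair g}

/-- Lift the section to `D`, differentiate there, and take the part again. -/
theorem isStable_part (hc : IsLeviCivita g c) (hD : IsGenQK g c D) {ε : ℝ}
    (hε : ε = 1 ∨ ε = -1) : IsStable E (homCov c c) (fun x => (D x).map (part g x ε)) := by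
  intro U u hU hu huD x hx X
  obtain ⟨v, hv, hvD⟩ := hD.1.exists_section hU hu hε huD
  refine ⟨_, hD.2 U v hU hv (fun y hy => (hvD y hy).1) x hx X, ?_⟩
  rw [part_homCov hc hU hv (fun y hy => hD.1.preservesHalves (hvD y hy).1) hx X hε,
    homCov_congr hU (hv.part (g := g) hU ε) (fun y hy => (hvD y hy).2) hx]

/-- For a section `v` of `D` with `v⁻ = u`, stability puts `∇v` in `D`, so `f(∇u) = f((∇v)⁻) = (∇v)⁺
= ∇(v⁺) = ∇f(u)`. -/
theorem QuatPair.IsInducedBy.isParallel (hp : p.IsInducedBy D) (hc : IsLeviCivita g c)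
    (hD : IsGenQK g c D) : p.IsParallel c := by
  intro U u hU hu huD x hx X
  obtain ⟨v, hv, hvD⟩ := hD.1.exists_section hU hu (.inr rfl) fun y hy => (hp y).2.1 ▸ huD y hy
  have hP := fun y hy => hD.1.preservesHalves (hvD y hy).1
  have hmem := hD.2 U v hU hv (fun y hy => (hvD y hy).1) x hx X
  have hm : part g x (-1) (homCov (genCov c) (genCov c) v x X) = homCov c c u x X := by
    rw [part_homCov hc hU hv hP hx X (.inr rfl),
      homCov_congr hU (hv.part (g := g) hU (-1)) (fun y hy => (hvD y hy).2) hx]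
  refine ⟨hm ▸ hp.part_mem hmem, ?_⟩
  have happly : ∀ y ∈ U, part g y 1 (v y) = applyIso p.f u y := by
    intro y hy
    rw [applyIso_of_mem _ (huD y hy), ← hp.f_part (hvD y hy).1]
    congr 3
    exact (hvD y hy).2
  rw [← homCov_congr hU (hv.part (g := g) hU 1) happly hx,
    ← part_homCov hc hU hv hP hx X (.inl rfl), ← hp.f_part hmem]
  congr 3

/-- The criterion `mem_iff` is checked for `∇u`: it preserves the halves, and `IsParallel` applied
to `u⁻` gives both `∇u⁻ ∈ D⁻` and `f(∇u⁻) = ∇u⁺`. -/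
theorem QuatPair.IsInducedBy.isStable (hp : p.IsInducedBy D) (hc : IsLeviCivita g c)
    (hD : IsGenAQH g D) (hpar : p.IsParallel c) :
    IsStable (E × (E →L[ℝ] ℝ)) (homCov (genCov c) (genCov c)) D := by
  intro U u hU hu huD x hx X
  have hP := fun y hy => hD.preservesHalves (huD y hy)
  have hm := part_homCov hc hU hu hP hx X (ε := -1) (.inr rfl)
  have hp1 := part_homCov hc hU hu hP hx X (ε := 1) (.inl rfl)
  obtain ⟨hmem, hf⟩ := hpar U (fun y => part g y (-1) (u y)) hU (hu.part hU (-1))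
    (fun y hy => hp.part_mem (huD y hy)) x hx X
  refine hp.mem_iff.2 ⟨preservesHalves_homCov hc hU hu hP hx X, hm ▸ hmem, ?_⟩
  have happly : ∀ y ∈ U, part g y 1 (u y) = applyIso p.f (fun y => part g y (-1) (u y)) y := by
    intro y hy
    rw [applyIso_of_mem _ (hp.part_mem (huD y hy)), ← hp.f_part (huD y hy)]
  rw [hp1, homCov_congr hU (hu.part (g := g) hU 1) happly hx, hf]
  congr 3

theorem QuatPair.IsInducedBy.isGenQK_iff (hp : p.IsInducedBy D) (hc : IsLeviCivita g c)
    (hD : IsGenAQH g D) :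
    IsGenQK g c D ↔ (IsQK g c p.Dp ∧ IsQK g c p.Dm) ∧ p.IsParallel c := by
  constructor
  · intro h
    have h1 : p.Dp = fun x => (D x).map (part g x 1) := funext fun x => (hp x).1
    have h2 : p.Dm = fun x => (D x).map (part g x (-1)) := funext fun x => (hp x).2.1
    refine ⟨⟨⟨p.isAQH_Dp, ?_⟩, ⟨p.isAQH_Dm, ?_⟩⟩, hp.isParallel hc h⟩
    · rw [h1]
      exact isStable_part hc h (.inl rfl)
    · rw [h2]
      exact isStable_part hc h (.inr rfl)
  · rintro ⟨-, hpar⟩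
    exact ⟨hD, hp.isStable hc hD hpar⟩

end Parallel
end GenQuat

end

theorem proposition3 {m : ℕ} {M : Type*} [TopologicalSpace M]
    [ChartedSpace (EuclideanSpace ℝ (Fin m)) M] [IsManifold (𝓡 m) ∞ M]
    (g : ContMDiffRiemannianMetric (𝓡 m) ∞ (EuclideanSpace ℝ (Fin m))
      (fun x : M => TangentSpace (𝓡 m) x)) :
    ∃ Φ : {D : Π x : M, Submodule ℝ (GenQuat.GenTangent (𝓡 m) x →L[ℝ] GenQuat.GenTangent (𝓡 m) x) //
        GenQuat.IsGenAQH g D} ≃ GenQuat.QuatPair g,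
      (∀ D, (Φ D).IsInducedBy D.1) ∧
      ∀ c : CovariantDerivative (𝓡 m) (EuclideanSpace ℝ (Fin m))
          (fun x : M => TangentSpace (𝓡 m) x),
        GenQuat.IsLeviCivita g c →
        ∀ D, GenQuat.IsGenQK g c D.1 ↔
          (GenQuat.IsQK g c (Φ D).Dp ∧ GenQuat.IsQK g c (Φ D).Dm) ∧ (Φ D).IsParallel c :=
  ⟨GenQuat.QuatPair.inducedEquiv g, GenQuat.QuatPair.isInducedBy_inducedEquiv, fun _ hc D =>
    (GenQuat.QuatPair.isInducedBy_inducedEquiv D).isGenQK_iff hc D.2⟩
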